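/- Let $(M,L)$ be a pseudo-Finsler manifold: $A\subset TM\setminus\{0\}$ is open and conic ($\lambda v\in A$ for $v\in A$, $\lambda>0$), and $L:A\to\mathbb R$ is smooth with $L(\lambda v)=\lambda^2L(v)$ for $\lambda>0$ and with non-degenerate fundamental tensor $g_v(u,w)=\frac12\frac{\partial^2}{\partial s\,\partial t}L(v+su+tw)\big|_{s=t=0}$ for every $v\in A$. Let $C_v(u,w,z)=\frac12\frac{\partial}{\partial t}g_{v+tz}(u,w)\big|_{t=0}$ be its Cartan tensor. The Levi-Civita-Chern connection $\widetilde\nabla$ of $(M,L)$ is the unique $A$-anisotropic connection $(v,X,Y)\mapsto\widetilde\nabla^v_XY\in T_{\pi(v)}M$ that is torsion-free, $\widetilde\nabla^v_XY-\widetilde\nabla^v_YX=[X,Y]_{\pi(v)}$, and almost $g$-compatible, $$X(g_V(Y,Z))=g_V(\widetilde\nabla^V_XY,Z)+g_V(Y,\widetilde\nabla^V_XZ)+2C_V(\widetilde\nabla^V_XV,Y,Z)$$ for all local vector fields $V,X,Y,Z$ with $V$ taking values in $A$. The geodesics of $(M,L)$ are the smooth curves $\gamma$, defined on open intervals, with $\gamma'\in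 A$ and $\widetilde\nabla^{\gamma'}_{\gamma'}\gamma'=0$. Let $S$ be an (immersed) submanifold of $M$ that is non-degenerate, i.e. $g_v$ is non-degenerate on $T_{\pi(v)}S$ for every $v\in A\cap TS$, and let $L|_S$ be the restriction of $L$ to $A\cap TS$, which is a pseudo-Finsler metric on $S$, with Levi-Civita-Chern connection $\nabla$. For $v\in A\cap TS$ and vector fields $X,Y$ on $S$ decompose $\widetilde\nabla^v_XY$ (computed with any extensions of $X,Y$ to $M$) as $$\widetilde\nabla^v_XY=\widehat\nabla^v_XY+\mathrm{II}_v(X,Y),\qquad \widehat\nabla^v_XY\in T_{\pi(v)}S,\quad \mathrm{II}_v(X,Y)\in (T_{\pi(v)}S)^{\perp_{g_v}},$$ and let $Q_v(X,Y)=\widehat\nabla^v_XY-\nabla^v_XY$; both $\mathrm{II}_v$ and $Q_v$ are bilinear on $T_{\pi(v)}S$. Say that $S$ is totally geodesic if every geodesic of $(S,L|_S)$ is a geodesic of $(M,L)$. Then $S$ is totally geodesic if and only if one of the following two equivalent conditions holds: (i) $\mathrm{II}_v(v,v)=0$ for all $v\in A\cap TS$; (ii) $\mathrm{II}_v(v,u)=0$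 for all $v\in A\cap TS$ and $u\in T_{\pi(v)}S$. In this case, $Q_v=0$ for all $v\in A\cap TS$. -/

import Mathlib

open scoped Manifold ContDiff Topology

noncomputable section

namespace PseudoFinsler

section Metric

variable {E : Type*} [NormedAddCommGroup E] [NormedSpace ℝ E]
  {M : Type*} [TopologicalSpace M] [ChartedSpace E M]

/-- The fundamental tensor `g_v(u,w) = 1/2 ∂²/∂s∂t L(v + s u + t w)` at `s = t = 0`. -/
def fundamentalTensor (L : TangentBundle 𝓘(ℝ, E) M → ℝ) (v : TangentBundle 𝓘(ℝ, E) M)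
    (u w : TangentSpace 𝓘(ℝ, E) v.proj) : ℝ :=
  (1 / 2) * deriv (fun s : ℝ => deriv (fun t : ℝ => L ⟨v.proj, v.2 + s • u + t • w⟩) 0) 0

/-- The Cartan tensor `C_v(u,w,z) = 1/2 ∂/∂t g_{v + t z}(u,w)` at `t = 0`. -/
def cartanTensor (L : TangentBundle 𝓘(ℝ, E) M → ℝ) (v : TangentBundle 𝓘(ℝ, E) M)
    (u w z : TangentSpace 𝓘(ℝ, E) v.proj) : ℝ :=
  (1 / 2) * deriv (fun t : ℝ => fundamentalTensor L ⟨v.proj, v.2 + t • z⟩ u w) 0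

/-- A (not necessarily smooth) vector field on a manifold `M` modelled on `E`. -/
abbrev VField (E : Type*) [NormedAddCommGroup E] [NormedSpace ℝ E]
    (M : Type*) [TopologicalSpace M] [ChartedSpace E M] : Type _ :=
  (q : M) → TangentSpace 𝓘(ℝ, E) q

/-- The real function `f` is smooth on a neighbourhood of `p`. -/
def FunSmoothNear (E : Type*) [NormedAddCommGroup E] [NormedSpace ℝ E]
    {M : Type*} [TopologicalSpace M] [ChartedSpace E M] (f : M → ℝ) (p : M) : Prop :=
  ∀ᶠ q in 𝓝 p, ContMDiffAt 𝓘(ℝ, E) 𝓘(ℝ, ℝ) ∞ f q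

/-- The derivative `X(f)` at `p` of the real function `f` along the vector field `X`. -/
def lieDeriv (X : VField E M) (f : M → ℝ) (p : M) : ℝ :=
  mfderiv 𝓘(ℝ, E) 𝓘(ℝ, ℝ) f p (X p)

/-- The velocity `γ'(t)` of a curve, as an element of the tangent bundle. -/
def velocity (γ : ℝ → M) (t : ℝ) : TangentBundle 𝓘(ℝ, E) M :=
  ⟨γ t, mfderiv 𝓘(ℝ, ℝ) 𝓘(ℝ, E) γ t (1 : ℝ)⟩

variable [IsManifold 𝓘(ℝ, E) ∞ M]

/-- The vector field `X` is smooth on a neighbourhood of `p`. -/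
def SmoothNear (X : VField E M) (p : M) : Prop :=
  ∀ᶠ q in 𝓝 p, ContMDiffAt 𝓘(ℝ, E) 𝓘(ℝ, E).tangent ∞
    (fun x => (⟨x, X x⟩ : TangentBundle 𝓘(ℝ, E) M)) q

variable (E M) in
/-- A pseudo-Finsler metric on `M`: a smooth function `L` on a conic open set `A` of nonzero tangent
vectors, positively homogeneous of degree two and with non-degenerate fundamental tensor. (The
values of `L` off `A` are irrelevant.) -/
structure Metric where
  /-- The conic domain. -/
  A : Set (TangentBundle 𝓘(ℝ, E) M)
  /-- The metric function. -/
  L : TangentBundle 𝓘(ℝ, E) M → ℝ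
  isOpen : IsOpen A
  ne_zero : ∀ v ∈ A, v.2 ≠ 0
  conic : ∀ v ∈ A, ∀ c : ℝ, 0 < c → (⟨v.proj, c • v.2⟩ : TangentBundle 𝓘(ℝ, E) M) ∈ A
  smooth : ContMDiffOn 𝓘(ℝ, E).tangent 𝓘(ℝ, ℝ) ∞ L A
  homogeneous : ∀ v ∈ A, ∀ c : ℝ, 0 < c → L ⟨v.proj, c • v.2⟩ = c ^ 2 * L v
  nondegenerate : ∀ v ∈ A, ∀ u : TangentSpace 𝓘(ℝ, E) v.proj,
    (∀ w, fundamentalTensor L v u w = 0) → u = 0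

/-- `∇ v X Y` is meant as `∇^v_X Y ∈ T_{π(v)}M`. -/
abbrev PreConnection (E : Type*) [NormedAddCommGroup E] [NormedSpace ℝ E]
    (M : Type*) [TopologicalSpace M] [ChartedSpace E M] : Type _ :=
  (v : TangentBundle 𝓘(ℝ, E) M) → VField E M → VField E M → TangentSpace 𝓘(ℝ, E) v.proj

/-- `nabla` is an `A`-anisotropic linear connection. The vector fields and functions in `∇^v_X Y`
need to be smooth only near `π(v)`; what `nabla` does to other fields, or for `v ∉ A`, is
irrelevant. -/
structure IsAnisotropicConnection (A : Set (TangentBundle 𝓘(ℝ, E) M))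
    (nabla : PreConnection E M) : Prop where
  add_right : ∀ v ∈ A, ∀ X Y Z : VField E M,
    SmoothNear X v.proj → SmoothNear Y v.proj → SmoothNear Z v.proj →
    nabla v X (fun q => Y q + Z q) = nabla v X Y + nabla v X Z
  leibniz : ∀ v ∈ A, ∀ (f : M → ℝ) (X Y : VField E M),
    FunSmoothNear E f v.proj → SmoothNear X v.proj → SmoothNear Y v.proj →
    nabla v X (fun q => f q • Y q) = lieDeriv X f v.proj • Y v.proj + f v.proj • nabla v X Y
  smooth : ∀ v ∈ A, ∀ X Y : VField E M, SmoothNear X v.proj → SmoothNear Y v.proj →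
    ContMDiffAt 𝓘(ℝ, E).tangent 𝓘(ℝ, E).tangent ∞
      (fun v' => (⟨v'.proj, nabla v' X Y⟩ : TangentBundle 𝓘(ℝ, E) M)) v
  linear_left : ∀ v ∈ A, ∀ (f h : M → ℝ) (X Y Z : VField E M),
    FunSmoothNear E f v.proj → FunSmoothNear E h v.proj →
    SmoothNear X v.proj → SmoothNear Y v.proj → SmoothNear Z v.proj →
    nabla v (fun q => f q • X q + h q • Y q) Z
      = f v.proj • nabla v X Z + h v.proj • nabla v Y Z

/-- `nabla` is the Levi-Civita-Chern connection of the metric: an `A`-anisotropic connection that is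
torsion-free and almost `g`-compatible. -/
structure IsLeviCivitaChern (F : Metric E M) (nabla : PreConnection E M) : Prop
    extends IsAnisotropicConnection F.A nabla where
  torsion_free : ∀ v ∈ F.A, ∀ X Y : VField E M, SmoothNear X v.proj → SmoothNear Y v.proj →
    nabla v X Y - nabla v Y X = VectorField.mlieBracket 𝓘(ℝ, E) X Y v.proj
  compatible : ∀ (p : M) (V X Y Z : VField E M),
    SmoothNear V p → SmoothNear X p → SmoothNear Y p → SmoothNear Z p →
    (⟨p, V p⟩ : TangentBundle 𝓘(ℝ, E) M) ∈ F.A →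
    lieDeriv X (fun q => fundamentalTensor F.L ⟨q, V q⟩ (Y q) (Z q)) p
      = fundamentalTensor F.L ⟨p, V p⟩ (nabla ⟨p, V p⟩ X Y) (Z p)
        + fundamentalTensor F.L ⟨p, V p⟩ (Y p) (nabla ⟨p, V p⟩ X Z)
        + 2 * cartanTensor F.L ⟨p, V p⟩ (nabla ⟨p, V p⟩ X V) (Y p) (Z p)

/-- The Levi-Civita-Chern connection of a pseudo-Finsler metric, i.e. the (on `A`, and on fields
that are smooth near the base point) unique torsion-free `g`-compatible anisotropic connection. -/
def Metric.chern (F : Metric E M) : PreConnection E M :=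
  Classical.epsilon (IsLeviCivitaChern F)

/-- `γ` is a geodesic of the metric on the open interval `J`: it is smooth with velocities in `A`
and `∇^{γ'}_{γ'} γ' = 0`. As `γ' ≠ 0`, the velocity extends, near each parameter value, to a smooth
vector field `X`; the covariant derivative `∇^{γ'(t)}_X X` does not depend on the extension. -/
def Metric.IsGeodesic (F : Metric E M) (γ : ℝ → M) (J : Set ℝ) : Prop :=
  IsOpen J ∧ J.OrdConnected ∧ ContMDiffOn 𝓘(ℝ, ℝ) 𝓘(ℝ, E) ∞ γ J ∧
    ∀ t ∈ J, velocity γ t ∈ F.A ∧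
      ∃ X : VField E M, SmoothNear X (γ t) ∧
        (∀ᶠ s in 𝓝 t, X (γ s) = (velocity (E := E) γ s).2) ∧
        F.chern (velocity γ t) X X = 0

end Metric

section Submanifold

variable {E : Type*} [NormedAddCommGroup E] [NormedSpace ℝ E]
  {M : Type*} [TopologicalSpace M] [ChartedSpace E M]
  {E' : Type*} [NormedAddCommGroup E'] [NormedSpace ℝ E']
  {S : Type*} [TopologicalSpace S] [ChartedSpace E' S]

/-- The differential of `i` at `p`. -/
abbrev diff (E E' : Type*) [NormedAddCommGroup E] [NormedSpace ℝ E]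
    [NormedAddCommGroup E'] [NormedSpace ℝ E']
    {M : Type*} [TopologicalSpace M] [ChartedSpace E M]
    {S : Type*} [TopologicalSpace S] [ChartedSpace E' S] (i : S → M) (p : S) :
    TangentSpace 𝓘(ℝ, E') p →L[ℝ] TangentSpace 𝓘(ℝ, E) (i p) :=
  mfderiv 𝓘(ℝ, E') 𝓘(ℝ, E) i p

/-- The tangent vector of `M` given by the tangent vector `v` of `S`, so that `A ∩ TS` is the set of
all `v` with `push E i v ∈ A`. -/
abbrev push (E : Type*) [NormedAddCommGroup E] [NormedSpace ℝ E]
    {M : Type*} [TopologicalSpace M] [ChartedSpace E M]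
    {E' : Type*} [NormedAddCommGroup E'] [NormedSpace ℝ E']
    {S : Type*} [TopologicalSpace S] [ChartedSpace E' S]
    (i : S → M) (v : TangentBundle 𝓘(ℝ, E') S) : TangentBundle 𝓘(ℝ, E) M :=
  ⟨i v.proj, diff E E' i v.proj v.2⟩

theorem fundamentalTensor_push {i : S → M} (L : TangentBundle 𝓘(ℝ, E) M → ℝ)
    (v : TangentBundle 𝓘(ℝ, E') S) (u w : TangentSpace 𝓘(ℝ, E') v.proj) :
    fundamentalTensor (fun v' => L (push E i v')) v u w
      = fundamentalTensor L (push E i v) (diff E E' i v.proj u) (diff E E' i v.proj w) := by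
  simp [fundamentalTensor, push, map_add, map_smul]

theorem diff_injective {i : S → M} (hi : Manifold.IsImmersion 𝓘(ℝ, E') 𝓘(ℝ, E) ∞ i) (p : S) :
    Function.Injective (diff E E' i p) := by
  have h := hi.isImmersionAt p
  set φ := h.domChart with hφd
  set ψ := h.codChart with hψd
  have hφ : MDifferentiableAt 𝓘(ℝ, E') 𝓘(ℝ, E') φ p :=
    (contMDiffAt_of_mem_maximalAtlas h.domChart_mem_maximalAtlas
      h.mem_domChart_source).mdifferentiableAt (by simp)
  have hψ : MDifferentiableAt 𝓘(ℝ, E) 𝓘(ℝ, E) ψ (i p) :=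
    (contMDiffAt_of_mem_maximalAtlas h.codChart_mem_maximalAtlas
      h.mem_codChart_source).mdifferentiableAt (by simp)
  have hi' : MDifferentiableAt 𝓘(ℝ, E') 𝓘(ℝ, E) i p := hi.contMDiff.mdifferentiableAt (by simp)
  have hloc : (fun q => ψ (i q)) =ᶠ[𝓝 p] fun q => h.equiv (φ q, 0) := by
    filter_upwards [φ.open_source.mem_nhds h.mem_domChart_source] with q hq
    have hmem : φ q ∈ (φ.extend 𝓘(ℝ, E')).target := by simpa using φ.map_source hq
    have := h.writtenInCharts hmem
    simpa [← hφd, ← hψd, φ.left_inv hq] using this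
  let r : E →L[ℝ] E' := (ContinuousLinearMap.fst ℝ E' h.complement).comp
    (h.equiv.symm : E →L[ℝ] E' × h.complement)
  have hr : (r ∘ (ψ ∘ i)) =ᶠ[𝓝 p] φ := by
    filter_upwards [hloc] with q hq
    simp only [Function.comp_apply, hq, r]
    simp
  have hinj : Function.Injective (mfderiv 𝓘(ℝ, E') 𝓘(ℝ, E') φ p) := by
    have hφM : φ.MDifferentiable 𝓘(ℝ, E') 𝓘(ℝ, E') :=
      ⟨fun x hx => ((contMDiffAt_of_mem_maximalAtlas h.domChart_mem_maximalAtlas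
          hx).mdifferentiableAt (by simp)).mdifferentiableWithinAt,
        fun x hx => ((contMDiffAt_symm_of_mem_maximalAtlas h.domChart_mem_maximalAtlas
          hx).mdifferentiableAt (by simp)).mdifferentiableWithinAt⟩
    exact hφM.mfderiv_injective h.mem_domChart_source
  rw [← hr.mfderiv_eq,
    mfderiv_comp p (I' := 𝓘(ℝ, E)) r.mdifferentiableAt (hψ.comp p hi'),
    mfderiv_comp p hψ hi'] at hinj
  exact Function.Injective.of_comp (f := fun z => (mfderiv 𝓘(ℝ, E) 𝓘(ℝ, E') r _)
    (mfderiv 𝓘(ℝ, E) 𝓘(ℝ, E) ψ (i p) z)) hinj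

variable [IsManifold 𝓘(ℝ, E) ∞ M] [IsManifold 𝓘(ℝ, E') ∞ S]

/-- The immersed submanifold `i : S → M` of `(M, L)` is non-degenerate: for every `v ∈ A ∩ TS` the
restriction of `g_v` to the tangent space of `S` is non-degenerate. -/
def Metric.IsNondegenerateAlong (F : Metric E M) (i : S → M) : Prop :=
  ∀ v : TangentBundle 𝓘(ℝ, E') S, push E i v ∈ F.A →
    ∀ u : TangentSpace 𝓘(ℝ, E') v.proj,
      (∀ w : TangentSpace 𝓘(ℝ, E') v.proj,
        fundamentalTensor F.L (push E i v) (diff E E' i v.proj u) (diff E E' i v.proj w) = 0) →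
      u = 0

/-- The restriction `L|_S` of the metric to `A ∩ TS`, a pseudo-Finsler metric on `S`. -/
def Metric.restrict (F : Metric E M) {i : S → M}
    (hi : Manifold.IsImmersion 𝓘(ℝ, E') 𝓘(ℝ, E) ∞ i)
    (hnd : F.IsNondegenerateAlong (E' := E') i) : Metric E' S where
  A := {v | push E i v ∈ F.A}
  L := fun v => F.L (push E i v)
  isOpen := F.isOpen.preimage
    ((hi.contMDiff.contMDiff_tangentMap (m := ∞) le_rfl).continuous)
  ne_zero v hv h0 := F.ne_zero _ hv (by simp [push, h0])
  conic v hv c hc := by simpa [push] using F.conic _ hv c hc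
  smooth := F.smooth.comp (hi.contMDiff.contMDiff_tangentMap (m := ∞) le_rfl).contMDiffOn
    (fun _ hv => hv)
  homogeneous v hv c hc := by simpa [push] using F.homogeneous _ hv c hc
  nondegenerate v hv u hu := hnd v hv u fun w => by
    rw [← fundamentalTensor_push]; exact hu w

/-- `X'` is a vector field on `M`, smooth near `i p`, which extends the vector field `X` on `S`
near `p`. -/
def IsExtension (i : S → M) (p : S) (X : VField E' S) (X' : VField E M) : Prop :=
  SmoothNear X' (i p) ∧ ∀ᶠ q in 𝓝 p, X' (i q) = diff E E' i q (X q)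

/-- A chosen extension to `M` of a vector field on `S`. -/
def someExtension (i : S → M) (p : S) (X : VField E' S) : VField E M :=
  Classical.epsilon (IsExtension i p X)

/-- `∇̃^v_X Y` for `v ∈ A ∩ TS` and vector fields `X`, `Y` on `S`, where `∇̃` is the
Levi-Civita-Chern connection of `M`: the value `∇̃^v_X̃ Ỹ` for any extensions of `X`, `Y` to `M`. -/
def Metric.ambient (F : Metric E M) (i : S → M) (v : TangentBundle 𝓘(ℝ, E') S)
    (X Y : VField E' S) : TangentSpace 𝓘(ℝ, E) (i v.proj) :=
  F.chern (push E i v) (someExtension i v.proj X) (someExtension i v.proj Y)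

/-- The `g_v`-projection of a vector `z` of `M` to the tangent space of `S`, for `v ∈ A ∩ TS`: the
vector `t` tangent to `S` for which `z - t` is `g_v`-orthogonal to `S`. -/
def Metric.tangentPart (F : Metric E M) (i : S → M) (v : TangentBundle 𝓘(ℝ, E') S)
    (z : TangentSpace 𝓘(ℝ, E) (i v.proj)) : TangentSpace 𝓘(ℝ, E') v.proj :=
  Classical.epsilon fun t : TangentSpace 𝓘(ℝ, E') v.proj =>
    ∀ w : TangentSpace 𝓘(ℝ, E') v.proj,
      fundamentalTensor F.L (push E i v) (z - diff E E' i v.proj t) (diff E E' i v.proj w) = 0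

/-- The induced connection `∇̂^v_X Y`, the part of `∇̃^v_X Y` tangent to `S`. -/
def Metric.induced (F : Metric E M) (i : S → M) : PreConnection E' S :=
  fun v X Y => F.tangentPart i v (F.ambient i v X Y)

/-- `II_v(X,Y)` for vector fields on `S`, the part of `∇̃^v_X Y` which is `g_v`-orthogonal to `S`. -/
def Metric.secondFormField (F : Metric E M) (i : S → M) (v : TangentBundle 𝓘(ℝ, E') S)
    (X Y : VField E' S) : TangentSpace 𝓘(ℝ, E) (i v.proj) :=
  F.ambient i v X Y - diff E E' i v.proj (F.induced i v X Y)

/-- The second fundamental form `II_v(u,w) = II_v(X,Y)` for `v ∈ A ∩ TS`, where `X`, `Y` are any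
vector fields on `S` with values `u`, `w` at the base point. -/
def Metric.secondForm (F : Metric E M) (i : S → M) (v : TangentBundle 𝓘(ℝ, E') S)
    (u w : TangentSpace 𝓘(ℝ, E') v.proj) : TangentSpace 𝓘(ℝ, E) (i v.proj) :=
  F.secondFormField i v (FiberBundle.extend E' u) (FiberBundle.extend E' w)

/-- The difference tensor `Q_v(u,w) = ∇̂^v_X Y - ∇^v_X Y` for `v ∈ A ∩ TS`, where `∇` is the
Levi-Civita-Chern connection of `(S, L|_S)` and `X`, `Y` are any vector fields on `S` with values
`u`, `w` at the base point. -/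
def Metric.differenceTensor (F : Metric E M) {i : S → M}
    (hi : Manifold.IsImmersion 𝓘(ℝ, E') 𝓘(ℝ, E) ∞ i)
    (hnd : F.IsNondegenerateAlong (E' := E') i) (v : TangentBundle 𝓘(ℝ, E') S)
    (u w : TangentSpace 𝓘(ℝ, E') v.proj) : TangentSpace 𝓘(ℝ, E') v.proj :=
  F.induced i v (FiberBundle.extend E' u) (FiberBundle.extend E' w)
    - (F.restrict hi hnd).chern v (FiberBundle.extend E' u) (FiberBundle.extend E' w)

/-- `S` is totally geodesic: the geodesics of `(S, L|_S)` are also geodesics of `(M, L)`. -/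
def Metric.IsTotallyGeodesic (F : Metric E M) {i : S → M}
    (hi : Manifold.IsImmersion 𝓘(ℝ, E') 𝓘(ℝ, E) ∞ i)
    (hnd : F.IsNondegenerateAlong (E' := E') i) : Prop :=
  ∀ (γ : ℝ → S) (J : Set ℝ), (F.restrict hi hnd).IsGeodesic γ J → F.IsGeodesic (i ∘ γ) J

end Submanifold

end PseudoFinsler

end

open scoped Manifold ContDiff Topology

noncomputable section

namespace PseudoFinsler

set_option maxSynthPendingDepth 3

/-! ### Metrics on a vector space: symmetries and homogeneity of the derivatives of `L` -/

section Local

open ContinuousLinearMap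

variable {V : Type*} [NormedAddCommGroup V] [NormedSpace ℝ V]

/-! Everything is computed in charts where the immersion is a linear inclusion `ι`, so that `L|_S`
is `L` composed with `ι × ι`. Write g for the fundamental tensor, T for its vertical derivative
(twice the Cartan tensor) and γ for the formal Christoffel symbols of the first kind. The spray G
and the nonlinear connection N are given by g(G,·) = γ(v,v,·) and g(Na,·) = γ(a,v,·) - ½T(G,a,·),
and the connection is DY(X) + Γ_v(X,Y), where Γ is γ corrected by terms in T and N. By homogeneity T
vanishes once an argument is v, so Γ(a,v) = Na and Γ(v,v) = G, and geodesics solve c'' + G(c,c') =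
0. This formula gives existence of the Levi-Civita-Chern connection and a Koszul argument gives
uniqueness; hence the choice `Metric.chern` is the formula in every chart (`dcoord_chern`).

Derivatives along S of fields tangent to S are tangent to S. So II_v(u,w) = 0 exactly when
Γ_v(ιu,ιw) lies in the range of ι (`IsAdapted.secondForm_eq_zero_iff`), and (i) says that G is
tangent to S at all vectors of S.

The tensors g, γ and T restrict to S. The equation for G therefore restricts too, and a tangent G
must be the spray G' of `L|_S` (`IsLocalMetric.christoffel_radial_restrict`). Under (i) a geodesic
of S then has zero acceleration in M. Conversely, a geodesic of S starts at every v in A ∩ TS; if it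
is a geodesic of M, comparing the two equations gives G = ιG', which is (i).

The vertical derivative of G is 2N (`IsLocalMetric.fderiv_sprayTerm`). Differentiating (i) in a
direction u tangent to S hence makes Nu = Γ(v,u) tangent, which is (ii). Then N also restricts to
its analogue on S, so every term of the lowered Γ restricts, the difference of the two connections
is g_v-orthogonal to S, and Q = 0. -/

theorem minSmoothness_two_le : minSmoothness ℝ 2 ≤ ∞ := by
  simpa using ENat.LEInfty.out

/-- Half the Hessian of `L : V × V → ℝ` in the second variable. -/
def fiberHessian (L : V × V → ℝ) (z : V × V) : V →L[ℝ] V →L[ℝ] ℝ :=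
  (1 / 2 : ℝ) • (fderiv ℝ (fderiv ℝ L) z).bilinearComp (inr ℝ V V) (inr ℝ V V)

theorem fiberHessian_apply (L : V × V → ℝ) (z : V × V) (a b : V) :
    fiberHessian L z a b = (1 / 2) * fderiv ℝ (fderiv ℝ L) z (0, a) (0, b) := by
  simp [fiberHessian]

/-- The derivative of the fiber Hessian in the first variable. -/
def horizontalDeriv (L : V × V → ℝ) (z : V × V) : V →L[ℝ] V →L[ℝ] V →L[ℝ] ℝ :=
  (fderiv ℝ (fiberHessian L) z).comp (inl ℝ V V)

/-- The derivative of the fiber Hessian in the second variable, twice the Cartan tensor. -/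
def verticalDeriv (L : V × V → ℝ) (z : V × V) : V →L[ℝ] V →L[ℝ] V →L[ℝ] ℝ :=
  (fderiv ℝ (fiberHessian L) z).comp (inr ℝ V V)

theorem horizontalDeriv_apply (L : V × V → ℝ) (z : V × V) (a : V) :
    horizontalDeriv L z a = fderiv ℝ (fiberHessian L) z (a, 0) := rfl

theorem verticalDeriv_apply (L : V × V → ℝ) (z : V × V) (a : V) :
    verticalDeriv L z a = fderiv ℝ (fiberHessian L) z (0, a) := rfl

theorem fderiv_fiberHessian_apply (L : V × V → ℝ) (z w : V × V) :
    fderiv ℝ (fiberHessian L) z w = horizontalDeriv L z w.1 + verticalDeriv L z w.2 := by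
  rw [horizontalDeriv_apply, verticalDeriv_apply, ← map_add]
  simp

/-- The formal Christoffel symbols of the first kind of the fiber Hessian. -/
def formalChristoffel (L : V × V → ℝ) (z : V × V) : V →L[ℝ] V →L[ℝ] V →L[ℝ] ℝ :=
  (1 / 2 : ℝ) • (horizontalDeriv L z + (horizontalDeriv L z).flip
    - ((flipₗᵢ ℝ V V ℝ : (V →L[ℝ] V →L[ℝ] ℝ) ≃ₗᵢ[ℝ] _).toContinuousLinearEquiv :
        (V →L[ℝ] V →L[ℝ] ℝ) →L[ℝ] V →L[ℝ] V →L[ℝ] ℝ).comp (horizontalDeriv L z).flip)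

theorem formalChristoffel_apply (L : V × V → ℝ) (z : V × V) (a b c : V) :
    formalChristoffel L z a b c = (1 / 2) * (horizontalDeriv L z a b c + horizontalDeriv L z b a c
      - horizontalDeriv L z c a b) := by
  simp [formalChristoffel]

/-- The quadratic part of the geodesic spray, without the differentiation term. -/
def sprayTerm (L : V × V → ℝ) (z : V × V) : V :=
  (fiberHessian L z).inverse (formalChristoffel L z z.2 z.2)

/-- The nonlinear connection associated with the geodesic spray. -/
def nonlinearConnection (L : V × V → ℝ) (z : V × V) : V →L[ℝ] V :=
  (fiberHessian L z).inverse.comp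
    ((formalChristoffel L z).flip z.2 - (1 / 2 : ℝ) • verticalDeriv L z (sprayTerm L z))

/-- The Christoffel symbols of the Levi-Civita-Chern connection, lowered with the fiber Hessian. -/
def loweredChristoffel (L : V × V → ℝ) (z : V × V) : V →L[ℝ] V →L[ℝ] V →L[ℝ] ℝ :=
  formalChristoffel L z
    - (1 / 2 : ℝ) • (verticalDeriv L z).comp (nonlinearConnection L z)
    - (1 / 2 : ℝ) • ((verticalDeriv L z).comp (nonlinearConnection L z)).flip
    + (1 / 2 : ℝ) • (((compL ℝ V V ℝ).flip (nonlinearConnection L z)).postcomp V).comp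
        (verticalDeriv L z)

/-- The Christoffel symbols of the Levi-Civita-Chern connection. -/
def christoffel (L : V × V → ℝ) (z : V × V) : V →L[ℝ] V →L[ℝ] V :=
  ((fiberHessian L z).inverse.postcomp V).comp (loweredChristoffel L z)

theorem loweredChristoffel_apply (L : V × V → ℝ) (z : V × V) (a b c : V) :
    loweredChristoffel L z a b c = formalChristoffel L z a b c
      - (1 / 2) * verticalDeriv L z (nonlinearConnection L z a) b c
      - (1 / 2) * verticalDeriv L z (nonlinearConnection L z b) a c
      + (1 / 2) * verticalDeriv L z a b (nonlinearConnection L z c) := by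
  simp [loweredChristoffel]

/-- A pseudo-Finsler metric `L` on the open conic subset `A` of the tangent bundle `V × V` of a
vector space. -/
structure IsLocalMetric (L : V × V → ℝ) (A : Set (V × V)) : Prop where
  isOpen : IsOpen A
  contDiffOn : ContDiffOn ℝ ∞ L A
  conic : ∀ z ∈ A, ∀ c : ℝ, 0 < c → (z.1, c • z.2) ∈ A
  homogeneous : ∀ z ∈ A, ∀ c : ℝ, 0 < c → L (z.1, c • z.2) = c ^ 2 * L z
  nondegenerate : ∀ z ∈ A, ∀ a, (∀ b, fiberHessian L z a b = 0) → a = 0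

namespace IsLocalMetric

variable {L : V × V → ℝ} {A : Set (V × V)} (h : IsLocalMetric L A)
include h

theorem contDiffAt {z : V × V} (hz : z ∈ A) : ContDiffAt ℝ ∞ L z :=
  h.contDiffOn.contDiffAt (h.isOpen.mem_nhds hz)

theorem contDiffAt_fderiv {z : V × V} (hz : z ∈ A) : ContDiffAt ℝ ∞ (fderiv ℝ L) z :=
  (h.contDiffAt hz).fderiv_right (by simp)

theorem contDiffAt_fderiv_fderiv {z : V × V} (hz : z ∈ A) :
    ContDiffAt ℝ ∞ (fderiv ℝ (fderiv ℝ L)) z :=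
  (h.contDiffAt_fderiv hz).fderiv_right (by simp)

theorem contDiffAt_fiberHessian {z : V × V} (hz : z ∈ A) : ContDiffAt ℝ ∞ (fiberHessian L) z := by
  -- Restricting a bilinear form to vertical vectors is a fixed continuous linear map, so the
  -- smoothness of D²L is inherited.
  let T : ((V × V) →L[ℝ] (V × V) →L[ℝ] ℝ) →L[ℝ] V →L[ℝ] V →L[ℝ] ℝ :=
    ((compL ℝ V (V × V) ℝ).flip (inr ℝ V V)).postcomp V ∘L
      (compL ℝ V (V × V) ((V × V) →L[ℝ] ℝ)).flip (inr ℝ V V)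
  have : fiberHessian L = fun z => (1 / 2 : ℝ) • T (fderiv ℝ (fderiv ℝ L) z) := by
    funext z; ext a b; simp [fiberHessian_apply, T]
  rw [this]
  exact (T.contDiff.contDiffAt.comp z (h.contDiffAt_fderiv_fderiv hz)).const_smul _

theorem contDiffAt_fderiv_fiberHessian {z : V × V} (hz : z ∈ A) :
    ContDiffAt ℝ ∞ (fderiv ℝ (fiberHessian L)) z :=
  (h.contDiffAt_fiberHessian hz).fderiv_right (by simp)

theorem hasFDerivAt_fiberHessian {z : V × V} (hz : z ∈ A) :
    HasFDerivAt (fiberHessian L) (fderiv ℝ (fiberHessian L) z) z :=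
  ((h.contDiffAt_fiberHessian hz).differentiableAt (by simp)).hasFDerivAt

theorem fiberHessian_comm {z : V × V} (hz : z ∈ A) (a b : V) :
    fiberHessian L z a b = fiberHessian L z b a := by
  rw [fiberHessian_apply, fiberHessian_apply,
    ((h.contDiffAt hz).isSymmSndFDerivAt minSmoothness_two_le).eq]

theorem fderiv_fiberHessian_apply_apply {z : V × V} (hz : z ∈ A) (w : V × V) (a b : V) :
    fderiv ℝ (fiberHessian L) z w a b
      = (1 / 2) * fderiv ℝ (fderiv ℝ (fderiv ℝ L)) z w (0, a) (0, b) := by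
  have h1 : HasFDerivAt (fun z => fiberHessian L z a b) _ z :=
    ((h.hasFDerivAt_fiberHessian hz).clm_apply (hasFDerivAt_const a z)).clm_apply
      (hasFDerivAt_const b z)
  have h0 := ((h.contDiffAt_fderiv_fderiv hz).differentiableAt (by simp)).hasFDerivAt
  have h2 : HasFDerivAt (fun z => (1 / 2) * fderiv ℝ (fderiv ℝ L) z (0, a) (0, b)) _ z :=
    ((h0.clm_apply (hasFDerivAt_const ((0, a) : V × V) z)).clm_apply
      (hasFDerivAt_const ((0, b) : V × V) z)).const_mul (1 / 2)
  simp_rw [← fiberHessian_apply] at h2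
  simpa using congrArg (fun f => f w) (h1.unique h2)

theorem fderiv_fiberHessian_comm {z : V × V} (hz : z ∈ A) (w : V × V) (a b : V) :
    fderiv ℝ (fiberHessian L) z w a b = fderiv ℝ (fiberHessian L) z w b a := by
  have h1 (a b : V) : HasFDerivAt (fun z => fiberHessian L z a b) _ z :=
    ((h.hasFDerivAt_fiberHessian hz).clm_apply (hasFDerivAt_const a z)).clm_apply
      (hasFDerivAt_const b z)
  have h2 := (h1 b a).congr_of_eventuallyEq (f₁ := fun z => fiberHessian L z a b) (by
    filter_upwards [h.isOpen.mem_nhds hz] with y hy using h.fiberHessian_comm hy a b)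
  simpa using congrArg (fun f => f w) ((h1 a b).unique h2)

theorem horizontalDeriv_comm {z : V × V} (hz : z ∈ A) (a b c : V) :
    horizontalDeriv L z a b c = horizontalDeriv L z a c b :=
  h.fderiv_fiberHessian_comm hz _ _ _

theorem verticalDeriv_comm {z : V × V} (hz : z ∈ A) (a b c : V) :
    verticalDeriv L z a b c = verticalDeriv L z a c b :=
  h.fderiv_fiberHessian_comm hz _ _ _

/-- Up to the factor 1/2 this is the third vertical derivative of `L`, and mixed partials of `fderiv
ℝ L` commute. With `verticalDeriv_comm` it makes the Cartan tensor totally symmetric. -/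
theorem verticalDeriv_swap {z : V × V} (hz : z ∈ A) (a b c : V) :
    verticalDeriv L z a b c = verticalDeriv L z b a c := by
  rw [verticalDeriv_apply, verticalDeriv_apply, h.fderiv_fiberHessian_apply_apply hz,
    h.fderiv_fiberHessian_apply_apply hz,
    ((h.contDiffAt_fderiv hz).isSymmSndFDerivAt minSmoothness_two_le).eq]

/-- Euler's relation for `L`. -/
theorem fderiv_radial {z : V × V} (hz : z ∈ A) : fderiv ℝ L z (0, z.2) = 2 * L z := by
  have h1 : HasDerivAt (fun c : ℝ => ((z.1, c • z.2) : V × V)) (0, z.2) 1 := by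
    simpa using (hasDerivAt_const (1 : ℝ) z.1).prodMk ((hasDerivAt_id (1 : ℝ)).smul_const z.2)
  have h2 : HasFDerivAt L (fderiv ℝ L z) ((fun c : ℝ => ((z.1, c • z.2) : V × V)) 1) := by
    simpa using ((h.contDiffAt hz).differentiableAt (by simp)).hasFDerivAt
  have h3 := h2.comp_hasDerivAt (1 : ℝ) h1
  have h4 : HasDerivAt (fun c : ℝ => c ^ 2 * L z) (2 * L z) 1 := by
    simpa using (hasDerivAt_pow 2 (1 : ℝ)).mul_const (L z)
  refine h3.unique (h4.congr_of_eventuallyEq ?_)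
  -- Homogeneity is available only for positive factors; near c = 1 that suffices.
  filter_upwards [lt_mem_nhds (zero_lt_one (α := ℝ))] with c hc
  exact h.homogeneous z hz c hc

omit h in
theorem hasFDerivAt_radial (z : V × V) :
    HasFDerivAt (fun z : V × V => ((0, z.2) : V × V)) ((inr ℝ V V).comp (snd ℝ V V)) z :=
  ((inr ℝ V V).comp (snd ℝ V V)).hasFDerivAt

/-- Differentiating Euler's relation vertically gives D²L(a,v) + DL(a) = 2 DL(a). -/
theorem fderiv_fderiv_radial {z : V × V} (hz : z ∈ A) (a : V) :
    fderiv ℝ (fderiv ℝ L) z (0, a) (0, z.2) = fderiv ℝ L z (0, a) := by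
  have h1 := ((h.contDiffAt_fderiv hz).differentiableAt (by simp)).hasFDerivAt.clm_apply
    (hasFDerivAt_radial z)
  have h2 := (((h.contDiffAt hz).differentiableAt (by simp)).hasFDerivAt.const_mul
    (2 : ℝ)).congr_of_eventuallyEq (f₁ := fun z : V × V => fderiv ℝ L z (0, z.2)) (by
      filter_upwards [h.isOpen.mem_nhds hz] with y hy using h.fderiv_radial hy)
  have h3 := congrArg (fun f => f (0, a)) (h1.unique h2)
  simp at h3
  linarith

/-- The fiber Hessian is homogeneous of degree zero. -/
theorem verticalDeriv_radial {z : V × V} (hz : z ∈ A) (a b : V) :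
    verticalDeriv L z a b z.2 = 0 := by
  rw [verticalDeriv_apply, h.fderiv_fiberHessian_apply_apply hz]
  -- One more vertical derivative, of D²L(b,v) = DL(b) along a, gives D³L(a,b,v) + D²L(b,a) =
  -- D²L(a,b).
  have h1 := (((h.contDiffAt_fderiv_fderiv hz).differentiableAt (by simp)).hasFDerivAt.clm_apply
    (hasFDerivAt_const ((0, b) : V × V) z)).clm_apply (hasFDerivAt_radial z)
  have h2 := (((h.contDiffAt_fderiv hz).differentiableAt (by simp)).hasFDerivAt.clm_apply
    (hasFDerivAt_const ((0, b) : V × V) z)).congr_of_eventuallyEq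
      (f₁ := fun z : V × V => fderiv ℝ (fderiv ℝ L) z (0, b) (0, z.2)) (by
      filter_upwards [h.isOpen.mem_nhds hz] with y hy using h.fderiv_fderiv_radial hy b)
  have h3 := congrArg (fun f => f (0, a)) (h1.unique h2)
  simp at h3
  rw [((h.contDiffAt hz).isSymmSndFDerivAt minSmoothness_two_le).eq (0, b) (0, a)] at h3
  linarith

theorem verticalDeriv_radial_mid {z : V × V} (hz : z ∈ A) (a b : V) :
    verticalDeriv L z a z.2 b = 0 := by
  rw [h.verticalDeriv_comm hz, h.verticalDeriv_radial hz]

/-- The horizontal derivative of the homogeneity relation of the fiber Hessian. -/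
theorem fderiv_fderiv_fiberHessian_radial {z : V × V} (hz : z ∈ A) (a b c : V) :
    fderiv ℝ (fderiv ℝ (fiberHessian L)) z (0, a) (c, 0) b z.2 = 0 := by
  -- With the derivatives exchanged, this is the derivative of T(a,b,v) = 0 in a horizontal
  -- direction, along which v is constant.
  rw [((h.contDiffAt_fiberHessian hz).isSymmSndFDerivAt minSmoothness_two_le).eq]
  have h1 := ((((h.contDiffAt_fderiv_fiberHessian hz).differentiableAt
    (by simp)).hasFDerivAt.clm_apply (hasFDerivAt_const ((0, a) : V × V) z)).clm_apply
      (hasFDerivAt_const b z)).clm_apply (hasFDerivAt_snd (p := z))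
  have h2 := (hasFDerivAt_const (𝕜 := ℝ) (0 : ℝ) z).congr_of_eventuallyEq
      (f₁ := fun z : V × V => fderiv ℝ (fiberHessian L) z (0, a) b z.2) (by
      filter_upwards [h.isOpen.mem_nhds hz] with y hy using h.verticalDeriv_radial hy a b)
  simpa using congrArg (fun f => f (c, 0)) (h1.unique h2)

theorem fderiv_fderiv_fiberHessian_comm {z : V × V} (hz : z ∈ A) (w w' : V × V) (a b : V) :
    fderiv ℝ (fderiv ℝ (fiberHessian L)) z w w' a b
      = fderiv ℝ (fderiv ℝ (fiberHessian L)) z w w' b a := by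
  have h1 (a b : V) := ((((h.contDiffAt_fderiv_fiberHessian hz).differentiableAt
    (by simp)).hasFDerivAt.clm_apply (hasFDerivAt_const w' z)).clm_apply
      (hasFDerivAt_const a z)).clm_apply (hasFDerivAt_const b z)
  have h2 := (h1 b a).congr_of_eventuallyEq
      (f₁ := fun z : V × V => fderiv ℝ (fiberHessian L) z w' a b) (by
      filter_upwards [h.isOpen.mem_nhds hz] with y hy using h.fderiv_fiberHessian_comm hy _ _ _)
  simpa using congrArg (fun f => f w) ((h1 a b).unique h2)

/-- Lets identities between vectors defined through the inverse of g be checked after lowering an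
index. -/
theorem eq_of_fiberHessian {z : V × V} (hz : z ∈ A) {a b : V}
    (hab : ∀ c, fiberHessian L z a c = fiberHessian L z b c) : a = b := by
  refine sub_eq_zero.1 (h.nondegenerate z hz _ fun c => ?_)
  simp [hab c]

variable [FiniteDimensional ℝ V]

/-- Non-degeneracy gives injectivity, and V and its dual have the same finite dimension. On A this
makes `ContinuousLinearMap.inverse` a genuine inverse instead of its default value zero. -/
theorem exists_equiv_fiberHessian {z : V × V} (hz : z ∈ A) :
    ∃ e : V ≃L[ℝ] (V →L[ℝ] ℝ), (e : V →L[ℝ] V →L[ℝ] ℝ) = fiberHessian L z := by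
  have hinj : Function.Injective (fiberHessian L z : V →ₗ[ℝ] V →L[ℝ] ℝ) := fun a b hab =>
    h.eq_of_fiberHessian hz fun c => congrArg (fun f : V →L[ℝ] ℝ => f c) hab
  have hdim : Module.finrank ℝ V = Module.finrank ℝ (V →L[ℝ] ℝ) := by
    rw [← (LinearMap.toContinuousLinearMap (𝕜 := ℝ) (E := V) (F' := ℝ)).finrank_eq]
    exact (Subspace.dual_finrank_eq (K := ℝ) (V := V)).symm
  refine ⟨(LinearEquiv.ofInjectiveOfFinrankEq _ hinj hdim).toContinuousLinearEquiv, ?_⟩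
  ext a b
  rfl

theorem fiberHessian_inverse {z : V × V} (hz : z ∈ A) (f : V →L[ℝ] ℝ) :
    fiberHessian L z ((fiberHessian L z).inverse f) = f := by
  obtain ⟨e, he⟩ := h.exists_equiv_fiberHessian hz
  rw [← he, ContinuousLinearMap.inverse_equiv]
  simp

theorem contDiffAt_inverse {z : V × V} (hz : z ∈ A) :
    ContDiffAt ℝ ∞ (fun z => (fiberHessian L z).inverse) z := by
  obtain ⟨e, he⟩ := h.exists_equiv_fiberHessian hz
  have := contDiffAt_map_inverse (n := ∞) e
  rw [he] at this
  exact this.comp z (h.contDiffAt_fiberHessian hz)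

end IsLocalMetric
end Local

/-! ### Algebraic identities and smoothness of the Christoffel symbols -/

section Local

open ContinuousLinearMap

variable {V : Type*} [NormedAddCommGroup V] [NormedSpace ℝ V]

namespace IsLocalMetric

variable {L : V × V → ℝ} {A : Set (V × V)} [FiniteDimensional ℝ V] (h : IsLocalMetric L A)
include h

theorem fiberHessian_christoffel {z : V × V} (hz : z ∈ A) (a b : V) :
    fiberHessian L z (christoffel L z a b) = loweredChristoffel L z a b :=
  h.fiberHessian_inverse hz _

theorem fiberHessian_sprayTerm {z : V × V} (hz : z ∈ A) :
    fiberHessian L z (sprayTerm L z) = formalChristoffel L z z.2 z.2 :=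
  h.fiberHessian_inverse hz _

theorem fiberHessian_nonlinearConnection {z : V × V} (hz : z ∈ A) (a c : V) :
    fiberHessian L z (nonlinearConnection L z a) c
      = formalChristoffel L z a z.2 c - (1 / 2) * verticalDeriv L z (sprayTerm L z) a c := by
  simp only [nonlinearConnection, coe_comp, Function.comp_apply]
  rw [h.fiberHessian_inverse hz]
  simp

theorem nonlinearConnection_radial {z : V × V} (hz : z ∈ A) :
    nonlinearConnection L z z.2 = sprayTerm L z := by
  refine h.eq_of_fiberHessian hz fun c => ?_
  rw [h.fiberHessian_nonlinearConnection hz, h.fiberHessian_sprayTerm hz,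
    h.verticalDeriv_radial_mid hz]
  simp

omit [FiniteDimensional ℝ V] in
theorem formalChristoffel_swap {z : V × V} (hz : z ∈ A) (a b : V) :
    formalChristoffel L z a b = formalChristoffel L z b a := by
  ext c
  rw [formalChristoffel_apply, formalChristoffel_apply, h.horizontalDeriv_comm hz c a b]
  ring

theorem christoffel_swap {z : V × V} (hz : z ∈ A) (a b : V) :
    christoffel L z a b = christoffel L z b a := by
  refine h.eq_of_fiberHessian hz fun c => ?_
  rw [h.fiberHessian_christoffel hz, h.fiberHessian_christoffel hz, loweredChristoffel_apply,
    loweredChristoffel_apply, h.formalChristoffel_swap hz, h.verticalDeriv_swap hz a b]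
  ring

/-- Two of the three T-terms have v as an argument and vanish. Since Nv = G, the third is the
correction -½T(G,a,·) in the definition of N; this is what makes the definition of Γ consistent. -/
theorem christoffel_radial {z : V × V} (hz : z ∈ A) (a : V) :
    christoffel L z a z.2 = nonlinearConnection L z a := by
  refine h.eq_of_fiberHessian hz fun c => ?_
  rw [h.fiberHessian_christoffel hz, loweredChristoffel_apply,
    h.fiberHessian_nonlinearConnection hz, h.nonlinearConnection_radial hz,
    h.verticalDeriv_radial_mid hz, h.verticalDeriv_radial_mid hz]
  ring

theorem christoffel_radial_radial {z : V × V} (hz : z ∈ A) :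
    christoffel L z z.2 z.2 = sprayTerm L z := by
  rw [h.christoffel_radial hz, h.nonlinearConnection_radial hz]

/-- The infinitesimal form of almost metric compatibility. -/
theorem horizontalDeriv_eq {z : V × V} (hz : z ∈ A) (a b c : V) :
    horizontalDeriv L z a b c = fiberHessian L z (christoffel L z a b) c
      + fiberHessian L z b (christoffel L z a c)
      + verticalDeriv L z (christoffel L z a z.2) b c := by
  -- In Γ_{abc} + Γ_{acb} + T(Na,b,c) the γ-terms add up to the horizontal derivative, and all
  -- T-terms cancel by total symmetry.
  rw [h.fiberHessian_comm hz b, h.christoffel_radial hz, h.fiberHessian_christoffel hz,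
    h.fiberHessian_christoffel hz, loweredChristoffel_apply, loweredChristoffel_apply,
    formalChristoffel_apply, formalChristoffel_apply,
    h.verticalDeriv_comm hz _ c b, h.horizontalDeriv_comm hz a c b,
    h.verticalDeriv_swap hz _ a c, h.verticalDeriv_comm hz a _ c,
    h.verticalDeriv_swap hz (nonlinearConnection L z c) a b,
    h.verticalDeriv_comm hz a _ b, h.horizontalDeriv_comm hz b a c,
    h.horizontalDeriv_comm hz c a b]
  ring

theorem contDiffOn_inverse : ContDiffOn ℝ ∞ (fun z => (fiberHessian L z).inverse) A :=
  fun _ hz => (h.contDiffAt_inverse hz).contDiffWithinAt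

omit [FiniteDimensional ℝ V] in
theorem contDiffOn_horizontalDeriv (a b c : V) :
    ContDiffOn ℝ ∞ (fun z => horizontalDeriv L z a b c) A := fun _ hz =>
  ((((h.contDiffAt_fderiv_fiberHessian hz).clm_apply contDiffAt_const).clm_apply
    contDiffAt_const).clm_apply contDiffAt_const).contDiffWithinAt

theorem contDiffOn_verticalDeriv : ContDiffOn ℝ ∞ (verticalDeriv L) A := by
  simp only [contDiffOn_clm_apply]
  exact fun a b c _ hz => ((((h.contDiffAt_fderiv_fiberHessian hz).clm_apply
    contDiffAt_const).clm_apply contDiffAt_const).clm_apply contDiffAt_const).contDiffWithinAt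

theorem contDiffOn_formalChristoffel : ContDiffOn ℝ ∞ (formalChristoffel L) A := by
  simp only [contDiffOn_clm_apply, formalChristoffel_apply]
  exact fun a b c => contDiffOn_const.mul (((h.contDiffOn_horizontalDeriv _ _ _).add
    (h.contDiffOn_horizontalDeriv _ _ _)).sub (h.contDiffOn_horizontalDeriv _ _ _))

theorem contDiffOn_sprayTerm : ContDiffOn ℝ ∞ (sprayTerm L) A :=
  h.contDiffOn_inverse.clm_apply
    ((h.contDiffOn_formalChristoffel.clm_apply contDiffOn_snd).clm_apply contDiffOn_snd)

theorem contDiffOn_nonlinearConnection : ContDiffOn ℝ ∞ (nonlinearConnection L) A := by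
  rw [contDiffOn_clm_apply]
  intro a
  have h1 : ContDiffOn ℝ ∞ (fun z => formalChristoffel L z a z.2) A :=
    (h.contDiffOn_formalChristoffel.clm_apply contDiffOn_const).clm_apply contDiffOn_snd
  have h2 : ContDiffOn ℝ ∞ (fun z => verticalDeriv L z (sprayTerm L z) a) A :=
    (h.contDiffOn_verticalDeriv.clm_apply h.contDiffOn_sprayTerm).clm_apply contDiffOn_const
  exact h.contDiffOn_inverse.clm_apply (h1.sub (h2.const_smul (1 / 2 : ℝ)))

theorem contDiffOn_loweredChristoffel : ContDiffOn ℝ ∞ (loweredChristoffel L) A := by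
  have hT := h.contDiffOn_verticalDeriv
  have hN (a : V) := h.contDiffOn_nonlinearConnection.clm_apply (contDiffOn_const (c := a))
  simp only [contDiffOn_clm_apply, loweredChristoffel_apply]
  exact fun a b c => ((((h.contDiffOn_formalChristoffel.clm_apply contDiffOn_const).clm_apply
    contDiffOn_const).clm_apply contDiffOn_const).sub (contDiffOn_const.mul
    (((hT.clm_apply (hN a)).clm_apply contDiffOn_const).clm_apply contDiffOn_const))).sub
    (contDiffOn_const.mul
    (((hT.clm_apply (hN b)).clm_apply contDiffOn_const).clm_apply contDiffOn_const)) |>.add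
    (contDiffOn_const.mul
    (((hT.clm_apply contDiffOn_const).clm_apply contDiffOn_const).clm_apply (hN c)))

theorem contDiffOn_christoffel : ContDiffOn ℝ ∞ (christoffel L) A := by
  simp only [contDiffOn_clm_apply]
  exact fun a b => h.contDiffOn_inverse.clm_apply
    ((h.contDiffOn_loweredChristoffel.clm_apply contDiffOn_const).clm_apply contDiffOn_const)

/-- The nonlinear connection is the vertical derivative of the spray. -/
theorem fderiv_sprayTerm {z : V × V} (hz : z ∈ A) (u : V) :
    fderiv ℝ (sprayTerm L) z (0, u) = (2 : ℝ) • nonlinearConnection L z u := by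
  refine h.eq_of_fiberHessian hz fun c => ?_
  have hf := ((h.contDiffOn_sprayTerm.contDiffAt (h.isOpen.mem_nhds hz)).differentiableAt
    (by simp)).hasFDerivAt
  have hG := ((h.contDiffAt_fderiv_fiberHessian hz).differentiableAt (by simp)).hasFDerivAt
  have hc := hasFDerivAt_const (𝕜 := ℝ) c z
  have hv : HasFDerivAt (fun z : V × V => z.2) (snd ℝ V V) z := hasFDerivAt_snd
  have hv' : HasFDerivAt (fun z : V × V => (z.2, (0 : V))) ((inl ℝ V V).comp (snd ℝ V V)) z :=
    ((inl ℝ V V).comp (snd ℝ V V)).hasFDerivAt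
  have hc' := hasFDerivAt_const (𝕜 := ℝ) ((c, 0) : V × V) z
  have h1 := ((h.hasFDerivAt_fiberHessian hz).clm_apply hf).clm_apply hc
  have h2 := (((hG.clm_apply hv').clm_apply hv).clm_apply hc).sub
    ((((hG.clm_apply hc').clm_apply hv).clm_apply hv).const_mul (1 / 2))
  have h3 := h2.congr_of_eventuallyEq (f₁ := fun z => fiberHessian L z (sprayTerm L z) c) (by
    filter_upwards [h.isOpen.mem_nhds hz] with y hy
    rw [h.fiberHessian_sprayTerm hy, formalChristoffel_apply]
    simp only [horizontalDeriv_apply, Pi.sub_apply]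
    ring)
  -- Vertical derivative along u of g(G,c) = H(v,v,c) - ½H(c,v,v), where H is the horizontal
  -- derivative of g. The terms differentiating H itself have v as a metric argument and vanish
  -- (`h5`, `h7`); what remains is g(DG(u),c) + T(u,G,c) = 2γ(u,v,c).
  have h4 := congrArg (fun f => f (0, u)) (h1.unique h3)
  have h5 := h.fderiv_fderiv_fiberHessian_radial hz u z.2 c
  have h7 : fderiv ℝ (fderiv ℝ (fiberHessian L)) z (0, u) (z.2, 0) z.2 c = 0 := by
    rw [h.fderiv_fderiv_fiberHessian_comm hz, h.fderiv_fderiv_fiberHessian_radial hz]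
  simp [h5, h7] at h4
  simp only [← horizontalDeriv_apply, ← verticalDeriv_apply] at h4
  have h8 : fiberHessian L z ((2 : ℝ) • nonlinearConnection L z u) c
    = 2 * (fiberHessian L z (nonlinearConnection L z u) c) := by simp
  rw [h8, h.fiberHessian_nonlinearConnection hz, formalChristoffel_apply]
  rw [h.verticalDeriv_swap hz] at h4
  rw [h.horizontalDeriv_comm hz c z.2 u] at h4
  linarith

end IsLocalMetric
end Local

/-! ### Uniqueness by the Koszul argument, and compatibility for vector fields -/

section Local

open ContinuousLinearMap

variable {V : Type*} [NormedAddCommGroup V] [NormedSpace ℝ V]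

/-- The Koszul argument: a symmetric difference of almost metric connections vanishes. -/
theorem eq_zero_of_symmetric_of_compatible {ι : Type*} {g : V →L[ℝ] V →L[ℝ] ℝ}
    {T : V →L[ℝ] V →L[ℝ] V →L[ℝ] ℝ} {v : V} (hg : ∀ a b, g a b = g b a)
    (hnd : ∀ a, (∀ b, g a b = 0) → a = 0) (hT₁ : ∀ a b c, T a b c = T a c b)
    (hTv : ∀ a b, T a b v = 0)
    (ev : ι → V) (hev : Function.Surjective ev) (D : ι → ι → V) (hD : ∀ X Y, D X Y = D Y X)
    (W : ι) (hW : ev W = v)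
    (hc : ∀ X Y Z, g (D X Y) (ev Z) + g (ev Y) (D X Z) + T (D X W) (ev Y) (ev Z) = 0)
    (X Y : ι) : D X Y = 0 := by
  -- Koszul's combination of the cyclic permutations of `hc`: the first plus the second minus the
  -- third.
  have key (X Y Z : ι) : 2 * g (D X Y) (ev Z) = - T (D X W) (ev Y) (ev Z)
      - T (D Y W) (ev Z) (ev X) + T (D Z W) (ev X) (ev Y) := by
    have h1 := hc X Y Z
    have h2 := hc Y Z X
    have h3 := hc Z X Y
    rw [hD Y Z, hg _ (D Y X), hD Y X] at h2
    rw [hD Z X, hg _ (D Z Y), hD Z Y, hg (D X Z)] at h3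
    rw [hg (D Y Z)] at *
    have h4 := hg (D Z Y) (ev X)
    rw [hD Z Y] at *
    linarith
  have of_pair {X Y : ι} (h : ∀ Z, 2 * g (D X Y) (ev Z) = 0) : D X Y = 0 := by
    refine hnd _ fun b => ?_
    obtain ⟨Z, rfl⟩ := hev b
    linarith [h Z]
  have hTm (a b) : T a v b = 0 := by rw [hT₁, hTv]
  -- Bootstrapping on the T-terms: for D W W each has an argument v; for D X W those left over
  -- contain D W W; for D X Y all contain some D · W.
  have hWW : D W W = 0 := of_pair fun Z => by simp [key, hW, hTv, hTm]
  have hXW (X) : D X W = 0 := of_pair fun Z => by simp [key, hW, hTv, hTm, hWW]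
  exact of_pair fun Z => by simp [key, hXW]

theorem hasDerivAt_comp_vertical {G : Type*} [NormedAddCommGroup G] [NormedSpace ℝ G]
    {f : V × V → G} {f' : V × V →L[ℝ] G} {z : V × V} (hf : HasFDerivAt f f' z) (c : V) :
    HasDerivAt (fun t : ℝ => f (z.1, z.2 + t • c)) (f' (0, c)) 0 := by
  have h1 : HasDerivAt (fun s : ℝ => z + s • ((0, c) : V × V)) (0, c) 0 := by
    simpa using ((hasDerivAt_id (0 : ℝ)).smul_const ((0, c) : V × V)).const_add z
  have h2 : HasFDerivAt f f' (z + (0 : ℝ) • ((0, c) : V × V)) := by simpa using hf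
  refine (h2.comp_hasDerivAt (0 : ℝ) h1).congr_of_eventuallyEq (.of_forall fun t => ?_)
  simp only [Function.comp_apply]
  congr 1
  ext <;> simp

theorem eventually_vertical_mem {A : Set (V × V)} (hA : IsOpen A) {z : V × V} (hz : z ∈ A)
    (c : V) : ∀ᶠ t : ℝ in 𝓝 0, ((z.1, z.2 + t • c) : V × V) ∈ A := by
  have h1 : Continuous fun t : ℝ => ((z.1, z.2 + t • c) : V × V) := by fun_prop
  exact h1.continuousAt (hA.mem_nhds (by simpa using hz))

/-- Bridges the definition of the fundamental tensor by iterated one-variable derivatives and the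
second Fréchet derivative. The inner derivative is known only at points of A, which contains the
line for small s. -/
theorem half_deriv_deriv_eq_fiberHessian {L : V × V → ℝ} {A : Set (V × V)} (hA : IsOpen A)
    (hL : ContDiffOn ℝ ∞ L A) {z : V × V} (hz : z ∈ A) (u w : V) :
    (1 / 2) * deriv (fun s : ℝ => deriv (fun t : ℝ => L (z.1, z.2 + s • u + t • w)) 0) 0
      = fiberHessian L z u w := by
  have hL (y : V × V) (hy : y ∈ A) : ContDiffAt ℝ ∞ L y := hL.contDiffAt (hA.mem_nhds hy)
  have hL' : ContDiffAt ℝ ∞ (fderiv ℝ L) z := (hL z hz).fderiv_right (by simp)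
  have h1 (y : V × V) (hy : y ∈ A) :
      deriv (fun t : ℝ => L (y.1, y.2 + t • w)) 0 = fderiv ℝ L y (0, w) :=
    (hasDerivAt_comp_vertical ((hL y hy).differentiableAt (by simp)).hasFDerivAt w).deriv
  have h2 : (fun s : ℝ => deriv (fun t : ℝ => L (z.1, z.2 + s • u + t • w)) 0)
      =ᶠ[𝓝 0] fun s => fderiv ℝ L (z.1, z.2 + s • u) (0, w) := by
    filter_upwards [eventually_vertical_mem hA hz u] with s hs using h1 _ hs
  have h4 := (hasDerivAt_comp_vertical (hL'.differentiableAt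
    (by simp)).hasFDerivAt u).clm_apply (hasDerivAt_const (0 : ℝ) ((0, w) : V × V))
  rw [h2.deriv_eq, fiberHessian_apply, h4.deriv]
  simp

namespace IsLocalMetric

variable {L : V × V → ℝ} {A : Set (V × V)} (h : IsLocalMetric L A)
include h

theorem hasDerivAt_fiberHessian_vertical {z : V × V} (hz : z ∈ A) (a b c : V) :
    HasDerivAt (fun t : ℝ => fiberHessian L (z.1, z.2 + t • c) a b)
      (verticalDeriv L z c a b) 0 := by
  have h3 := ((hasDerivAt_comp_vertical (h.hasFDerivAt_fiberHessian hz) c).clm_apply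
    (hasDerivAt_const (0 : ℝ) a)).clm_apply (hasDerivAt_const (0 : ℝ) b)
  simpa [← verticalDeriv_apply] using h3

/-- Almost metric compatibility for vector fields on a vector space. -/
theorem fderiv_fiberHessian_fields [FiniteDimensional ℝ V] {x : V} {U X Y Z : V → V}
    (hx : (x, U x) ∈ A) (hU : DifferentiableAt ℝ U x) (hY : DifferentiableAt ℝ Y x)
    (hZ : DifferentiableAt ℝ Z x) :
    fderiv ℝ (fun y => fiberHessian L (y, U y) (Y y) (Z y)) x (X x)
      = fiberHessian L (x, U x) (fderiv ℝ Y x (X x) + christoffel L (x, U x) (X x) (Y x)) (Z x)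
        + fiberHessian L (x, U x) (Y x) (fderiv ℝ Z x (X x) + christoffel L (x, U x) (X x) (Z x))
        + verticalDeriv L (x, U x) (fderiv ℝ U x (X x) + christoffel L (x, U x) (X x) (U x))
            (Y x) (Z x) := by
  have h1 : HasFDerivAt (fun y => (y, U y)) _ x := (hasFDerivAt_id x).prodMk hU.hasFDerivAt
  have h2 := (((h.hasFDerivAt_fiberHessian hx).comp x h1).clm_apply hY.hasFDerivAt).clm_apply
    hZ.hasFDerivAt
  have h3 := congrArg (fun f => f (X x)) h2.fderiv
  have h4 := h.horizontalDeriv_eq hx (X x) (Y x) (Z x)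
  simp only [Function.comp_apply, add_apply, flip_apply, coe_comp, fderiv_fiberHessian_apply,
    prod_apply, coe_id', id_eq] at h3
  rw [h3, h4]
  simp only [map_add, add_apply]
  ring

/-! ### Restriction of a metric to a linear subspace -/

section Restrict

variable {V' : Type*} [NormedAddCommGroup V'] [NormedSpace ℝ V'] {ι : V' →L[ℝ] V}
  {L' : V' × V' → ℝ} {A' : Set (V' × V')} (h' : IsLocalMetric L' A')
  (hA : ∀ z ∈ A', ι.prodMap ι z ∈ A) (hL : ∀ z ∈ A', L' z = L (ι.prodMap ι z))
include h' hA hL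

/-- Chain rule applied twice; as ι × ι is linear, no second derivative of the inclusion appears. -/
theorem fiberHessian_restrict {z : V' × V'} (hz : z ∈ A') (a b : V') :
    fiberHessian L' z a b = fiberHessian L (ι.prodMap ι z) (ι a) (ι b) := by
  have h1 (y) (hy : y ∈ A') (w) : fderiv ℝ L' y w = fderiv ℝ L (ι.prodMap ι y) (ι.prodMap ι w) := by
    have h2 := (((h.contDiffAt (hA y hy)).differentiableAt (by simp)).hasFDerivAt.comp y
      (ι.prodMap ι).hasFDerivAt).congr_of_eventuallyEq (f₁ := L')
        (by filter_upwards [h'.isOpen.mem_nhds hy] with y hy using hL y hy)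
    rw [h2.fderiv]; rfl
  have h3 := ((((h.contDiffAt_fderiv (hA z hz)).differentiableAt (by simp)).hasFDerivAt.comp z
    (ι.prodMap ι).hasFDerivAt).clm_apply
      (hasFDerivAt_const (ι.prodMap ι (0, b)) z)).congr_of_eventuallyEq
        (f₁ := fun y => fderiv ℝ L' y (0, b))
        (by filter_upwards [h'.isOpen.mem_nhds hz] with y hy using h1 y hy _)
  have h4 := ((h'.contDiffAt_fderiv hz).differentiableAt (by simp)).hasFDerivAt.clm_apply
    (hasFDerivAt_const ((0, b) : V' × V') z)
  have h5 := congrArg (fun f => f (0, a)) (h4.unique h3)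
  rw [fiberHessian_apply, fiberHessian_apply]
  congr 1
  simpa using h5

theorem fderiv_fiberHessian_restrict {z : V' × V'} (hz : z ∈ A') (w : V' × V') (a b : V') :
    fderiv ℝ (fiberHessian L') z w a b
      = fderiv ℝ (fiberHessian L) (ι.prodMap ι z) (ι.prodMap ι w) (ι a) (ι b) := by
  have h1 := (((h'.hasFDerivAt_fiberHessian hz).clm_apply (hasFDerivAt_const a z)).clm_apply
    (hasFDerivAt_const b z))
  have h2 := ((((h.hasFDerivAt_fiberHessian (hA z hz)).comp z
    (ι.prodMap ι).hasFDerivAt).clm_apply (hasFDerivAt_const (ι a) z)).clm_apply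
    (hasFDerivAt_const (ι b) z)).congr_of_eventuallyEq (f₁ := fun y => fiberHessian L' y a b)
      (by filter_upwards [h'.isOpen.mem_nhds hz] with y hy
            using h.fiberHessian_restrict h' hA hL hy a b)
  simpa using congrArg (fun f => f w) (h1.unique h2)

/-- Only derivatives of g enter, so no tangency is needed here, in contrast to G, N and Γ, whose
definitions invert g. -/
theorem formalChristoffel_restrict {z : V' × V'} (hz : z ∈ A') (a b c : V') :
    formalChristoffel L' z a b c = formalChristoffel L (ι.prodMap ι z) (ι a) (ι b) (ι c) := by
  simp only [formalChristoffel_apply, horizontalDeriv_apply,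
    h.fderiv_fiberHessian_restrict h' hA hL hz]
  simp

theorem verticalDeriv_restrict {z : V' × V'} (hz : z ∈ A') (a b c : V') :
    verticalDeriv L' z a b c = verticalDeriv L (ι.prodMap ι z) (ι a) (ι b) (ι c) := by
  simp only [verticalDeriv_apply, h.fderiv_fiberHessian_restrict h' hA hL hz]
  simp

variable [FiniteDimensional ℝ V] [FiniteDimensional ℝ V']

/-- The equation g(G,·) = γ(v,v,·) restricts term by term, and g is non-degenerate on the subspace,
so a tangent solution is the spray of the restricted metric. -/
theorem christoffel_radial_restrict {z : V' × V'} (hz : z ∈ A') {n : V'}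
    (hn : christoffel L (ι.prodMap ι z) (ι z.2) (ι z.2) = ι n) :
    n = christoffel L' z z.2 z.2 := by
  have h0 : sprayTerm L (ι.prodMap ι z) = ι n := by
    rw [← hn]; exact (h.christoffel_radial_radial (hA z hz)).symm
  refine h'.eq_of_fiberHessian hz fun c => ?_
  rw [h'.christoffel_radial_radial hz, h'.fiberHessian_sprayTerm hz,
    h.formalChristoffel_restrict h' hA hL hz, h.fiberHessian_restrict h' hA hL hz, ← h0,
    h.fiberHessian_sprayTerm (hA z hz)]
  rfl

/-- If the second fundamental form vanishes in the direction of the reference vector, then the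
tangential part of the ambient connection is the connection of the restricted metric. -/
theorem fiberHessian_christoffel_sub_eq_zero {z : V' × V'} (hz : z ∈ A')
    (hr : ∀ u, ∃ n, christoffel L (ι.prodMap ι z) (ι z.2) (ι u) = ι n) (a b c : V') :
    fiberHessian L (ι.prodMap ι z)
      (christoffel L (ι.prodMap ι z) (ι a) (ι b) - ι (christoffel L' z a b)) (ι c) = 0 := by
  have hAz := hA z hz
  have hG : sprayTerm L (ι.prodMap ι z) = ι (sprayTerm L' z) := by
    obtain ⟨n, hn⟩ := hr z.2
    rw [← h'.christoffel_radial_radial hz, ← h.christoffel_radial_restrict h' hA hL hz hn, ← hn]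
    exact (h.christoffel_radial_radial hAz).symm
  have hN (u : V') : nonlinearConnection L (ι.prodMap ι z) (ι u)
      = ι (nonlinearConnection L' z u) := by
    obtain ⟨n, hn⟩ := hr u
    rw [h.christoffel_swap hAz] at hn
    have h1 : nonlinearConnection L (ι.prodMap ι z) (ι u) = ι n :=
      (h.christoffel_radial hAz _).symm.trans hn
    rw [h1]
    congr 1
    refine h'.eq_of_fiberHessian hz fun c => ?_
    rw [h.fiberHessian_restrict h' hA hL hz, ← h1, h.fiberHessian_nonlinearConnection hAz,
      h'.fiberHessian_nonlinearConnection hz, h.formalChristoffel_restrict h' hA hL hz,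
      h.verticalDeriv_restrict h' hA hL hz, hG]
    rfl
  have h2 : fiberHessian L (ι.prodMap ι z) (ι (christoffel L' z a b)) (ι c)
      = loweredChristoffel L' z a b c := by
    rw [← h.fiberHessian_restrict h' hA hL hz, h'.fiberHessian_christoffel hz]
  rw [map_sub, sub_apply, h2, h.fiberHessian_christoffel hAz, loweredChristoffel_apply,
    loweredChristoffel_apply, hN, hN, hN]
  simp only [h.formalChristoffel_restrict h' hA hL hz, h.verticalDeriv_restrict h' hA hL hz,
    sub_self]

omit hL in
/-- Differentiating `II_v(v,v) = 0` in the reference vector gives `II_v(v,u) = 0`. -/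
theorem christoffel_mem_range
    (hr : ∀ z ∈ A', ∃ n, christoffel L (ι.prodMap ι z) (ι z.2) (ι z.2) = ι n)
    {z : V' × V'} (hz : z ∈ A') (u : V') :
    ∃ n, christoffel L (ι.prodMap ι z) (ι z.2) (ι u) = ι n := by
  have hAz := hA z hz
  have h3 := hasDerivAt_comp_vertical
    ((h.contDiffOn_sprayTerm.contDiffAt (h.isOpen.mem_nhds hAz)).differentiableAt
      (by simp)).hasFDerivAt (ι u)
  have hr' (y) (hy : y ∈ A') : sprayTerm L (ι y.1, ι y.2) ∈ ι.range := by
    obtain ⟨n, hn⟩ := hr y hy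
    exact ⟨n, hn.symm.trans (h.christoffel_radial_radial (hA y hy))⟩
  -- The difference quotients of G in the direction ιu lie in the range of ι; being closed, it
  -- contains their limit.
  have hR : IsClosed (ι.range : Set V) := ι.range.closed_of_finiteDimensional
  have h4 : fderiv ℝ (sprayTerm L) (ι.prodMap ι z) (0, ι u) ∈ ι.range := by
    refine hR.mem_of_tendsto h3.tendsto_slope_zero_right ?_
    filter_upwards [nhdsWithin_le_nhds (eventually_vertical_mem h'.isOpen hz u)] with s hs
    refine ι.range.smul_mem _ (ι.range.sub_mem ?_ ?_)
    · simpa using hr' _ hs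
    · simpa using hr' _ hz
  rw [h.fderiv_sprayTerm hAz] at h4
  -- The factor 1/2 undoes the 2 in DG = 2N.
  obtain ⟨n, hn⟩ := ι.range.smul_mem (1 / 2 : ℝ) h4
  refine ⟨n, ?_⟩
  rw [h.christoffel_swap hAz]
  refine (h.christoffel_radial hAz (ι u)).trans ?_
  simpa using hn.symm

end Restrict

end IsLocalMetric
end Local

/-! ### Coordinates of tangent vectors and vector fields in a chart -/

section Coordinates

variable {E : Type*} [NormedAddCommGroup E] [NormedSpace ℝ E]

theorem contMDiff_tangentBundle_mk :
    ContMDiff 𝓘(ℝ, E × E) 𝓘(ℝ, E).tangent ∞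
      (fun z : E × E => (⟨z.1, z.2⟩ : TangentBundle 𝓘(ℝ, E) E)) := by
  intro z
  rw [Bundle.contMDiffAt_totalSpace]
  refine ⟨contDiff_fst.contMDiff.contMDiffAt, ?_⟩
  have : ContMDiffAt 𝓘(ℝ, E × E) 𝓘(ℝ, E) ∞ (fun z : E × E => z.2) z :=
    contDiff_snd.contMDiff.contMDiffAt
  convert this using 1
  ext z
  simp

theorem contMDiff_tangentBundle_toProd :
    ContMDiff 𝓘(ℝ, E).tangent 𝓘(ℝ, E × E) ∞
      (fun v : TangentBundle 𝓘(ℝ, E) E => ((v.proj, v.snd) : E × E)) :=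
  (Bundle.contMDiff_proj (TangentSpace 𝓘(ℝ, E))).prodMk_space
    (contMDiff_snd_tangentBundle_modelSpace E 𝓘(ℝ, E))

variable {M : Type*} [TopologicalSpace M] [ChartedSpace E M]

theorem tangentBundle_mk_eq {p q : M} (h : p = q) {a b : E} (hab : a = b) :
    (⟨p, a⟩ : TangentBundle 𝓘(ℝ, E) M) = ⟨q, b⟩ := by
  subst h hab; rfl

/-- The differential of a chart, as a map to the model space. -/
def dcoord (e : OpenPartialHomeomorph M E) (p : M) : TangentSpace 𝓘(ℝ, E) p →L[ℝ] E :=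
  mfderiv 𝓘(ℝ, E) 𝓘(ℝ, E) e p

/-- The differential of the inverse of a chart, as a map from the model space. -/
def dcoordSymm (e : OpenPartialHomeomorph M E) (x : E) :
    E →L[ℝ] TangentSpace 𝓘(ℝ, E) (e.symm x) :=
  mfderiv 𝓘(ℝ, E) 𝓘(ℝ, E) e.symm x

/-- The coordinates of a tangent vector in a chart. -/
def tangentCoord (e : OpenPartialHomeomorph M E) (v : TangentBundle 𝓘(ℝ, E) M) : E × E :=
  (e v.proj, dcoord e v.proj v.2)

/-- The tangent vector with given coordinates in a chart. -/
def tangentCoordSymm (e : OpenPartialHomeomorph M E) (z : E × E) : TangentBundle 𝓘(ℝ, E) M :=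
  ⟨e.symm z.1, dcoordSymm e z.1 z.2⟩

/-- The coordinates of a vector field in a chart. -/
def fieldCoord (e : OpenPartialHomeomorph M E) (X : VField E M) (x : E) : E :=
  dcoord e (e.symm x) (X (e.symm x))

/-- The vector field with given coordinates in a chart. -/
def ofFieldCoord (e : OpenPartialHomeomorph M E) (f : E → E) : VField E M :=
  fun q => (dcoord e q).inverse (f (e q))

variable {e : OpenPartialHomeomorph M E}
  (he : e ∈ IsManifold.maximalAtlas 𝓘(ℝ, E) ∞ M)

include he

theorem mdifferentiable_of_mem_maximalAtlas : e.MDifferentiable 𝓘(ℝ, E) 𝓘(ℝ, E) :=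
  ⟨fun _ hx => ((contMDiffAt_of_mem_maximalAtlas he hx).mdifferentiableAt
      (by simp)).mdifferentiableWithinAt,
    fun _ hx => ((contMDiffAt_symm_of_mem_maximalAtlas he hx).mdifferentiableAt
      (by simp)).mdifferentiableWithinAt⟩

theorem dcoordSymm_dcoord {p : M} (hp : p ∈ e.source) (w : TangentSpace 𝓘(ℝ, E) p) :
    (dcoordSymm e (e p) (dcoord e p w) : E) = w :=
  congrArg (fun f : TangentSpace 𝓘(ℝ, E) p →L[ℝ] TangentSpace 𝓘(ℝ, E) p => f w)
    ((mdifferentiable_of_mem_maximalAtlas he).symm_comp_deriv hp)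

theorem dcoord_dcoordSymm {x : E} (hx : x ∈ e.target) (w : E) :
    dcoord e (e.symm x) (dcoordSymm e x w) = w :=
  congrArg (fun f : TangentSpace 𝓘(ℝ, E) x →L[ℝ] TangentSpace 𝓘(ℝ, E) x => f w)
    ((mdifferentiable_of_mem_maximalAtlas he).comp_symm_deriv hx)

theorem dcoord_injective {p : M} (hp : p ∈ e.source) : Function.Injective (dcoord e p) :=
  (mdifferentiable_of_mem_maximalAtlas he).mfderiv_injective hp

theorem dcoord_inverse {p : M} (hp : p ∈ e.source) (a : E) :
    dcoord e p ((dcoord e p).inverse a) = a := by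
  let φ : TangentSpace 𝓘(ℝ, E) p ≃L[ℝ] E := (mdifferentiable_of_mem_maximalAtlas he).mfderiv hp
  have h : dcoord e p = (φ : TangentSpace 𝓘(ℝ, E) p →L[ℝ] E) := rfl
  rw [h, ContinuousLinearMap.inverse_equiv]
  exact φ.apply_symm_apply a

theorem tangentCoordSymm_tangentCoord {v : TangentBundle 𝓘(ℝ, E) M} (hv : v.proj ∈ e.source) :
    tangentCoordSymm e (tangentCoord e v) = v :=
  tangentBundle_mk_eq (e.left_inv hv) (dcoordSymm_dcoord he hv v.2)

theorem tangentCoord_tangentCoordSymm {z : E × E} (hz : z.1 ∈ e.target) :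
    tangentCoord e (tangentCoordSymm e z) = z :=
  Prod.ext (e.right_inv hz) (dcoord_dcoordSymm he hz z.2)

omit he in
theorem fieldCoord_apply {p : M} (hp : p ∈ e.source) (X : VField E M) :
    fieldCoord e X (e p) = dcoord e p (X p) := by
  rw [fieldCoord, e.left_inv hp]

theorem fieldCoord_ofFieldCoord {x : E} (hx : x ∈ e.target) (f : E → E) :
    fieldCoord e (ofFieldCoord e f) x = f x := by
  rw [fieldCoord, ofFieldCoord, dcoord_inverse he (e.map_target hx), e.right_inv hx]

variable [IsManifold 𝓘(ℝ, E) ∞ M]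

theorem contMDiffOn_tangentCoordSymm :
    ContMDiffOn 𝓘(ℝ, E × E) 𝓘(ℝ, E).tangent ∞ (tangentCoordSymm e) (Prod.fst ⁻¹' e.target) := by
  have h1 := (contMDiffOn_symm_of_mem_maximalAtlas he).contMDiffOn_tangentMapWithin (m := ∞)
    (by simp) e.open_target.uniqueMDiffOn
  have h2 := h1.comp (s := Prod.fst ⁻¹' e.target)
    (contMDiff_tangentBundle_mk (E := E)).contMDiffOn (fun z hz => hz)
  refine h2.congr fun z hz => ?_
  refine tangentBundle_mk_eq rfl ?_
  change _ = mfderivWithin _ _ _ _ _ _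
  rw [mfderivWithin_of_isOpen e.open_target hz]
  rfl

theorem contMDiffOn_tangentCoord :
    ContMDiffOn 𝓘(ℝ, E).tangent 𝓘(ℝ, E × E) ∞ (tangentCoord e)
      (Bundle.TotalSpace.proj ⁻¹' e.source) := by
  have h1 := (contMDiffOn_of_mem_maximalAtlas he).contMDiffOn_tangentMapWithin (m := ∞)
    (by simp) e.open_source.uniqueMDiffOn
  have h2 := (contMDiff_tangentBundle_toProd (E := E)).comp_contMDiffOn h1
  refine h2.congr fun v hv => ?_
  refine Prod.ext rfl ?_
  change _ = mfderivWithin _ _ _ _ _ _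
  rw [mfderivWithin_of_isOpen e.open_source hv]
  rfl

theorem contMDiffAt_tangentCoordSymm {z : E × E} (hz : z.1 ∈ e.target) :
    ContMDiffAt 𝓘(ℝ, E × E) 𝓘(ℝ, E).tangent ∞ (tangentCoordSymm e) z :=
  (contMDiffOn_tangentCoordSymm he).contMDiffAt
    ((e.open_target.preimage continuous_fst).mem_nhds hz)

theorem contMDiffAt_tangentCoord {v : TangentBundle 𝓘(ℝ, E) M} (hv : v.proj ∈ e.source) :
    ContMDiffAt 𝓘(ℝ, E).tangent 𝓘(ℝ, E × E) ∞ (tangentCoord e) v :=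
  (contMDiffOn_tangentCoord he).contMDiffAt
    ((e.open_source.preimage (FiberBundle.continuous_proj E _)).mem_nhds hv)

theorem contDiffAt_fieldCoord {p : M} (hp : p ∈ e.source) {X : VField E M}
    (hX : ContMDiffAt 𝓘(ℝ, E) 𝓘(ℝ, E).tangent ∞
      (fun x => (⟨x, X x⟩ : TangentBundle 𝓘(ℝ, E) M)) p) :
    ContDiffAt ℝ ∞ (fieldCoord e X) (e p) := by
  have h1 : ContMDiffAt 𝓘(ℝ, E) 𝓘(ℝ, E) ∞ e.symm (e p) :=
    contMDiffAt_symm_of_mem_maximalAtlas he (e.map_source hp)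
  rw [← e.left_inv hp] at hX
  have h2 := ContMDiffAt.comp (e p) (contMDiffAt_tangentCoord he
    (v := ⟨e.symm (e p), X (e.symm (e p))⟩) (by rwa [e.left_inv hp])) (hX.comp (e p) h1)
  exact contDiff_snd.contDiffAt.comp _ h2.contDiffAt

theorem contMDiffAt_of_fieldCoord {p : M} (hp : p ∈ e.source) {X : VField E M}
    (hX : ContDiffAt ℝ ∞ (fieldCoord e X) (e p)) :
    ContMDiffAt 𝓘(ℝ, E) 𝓘(ℝ, E).tangent ∞
      (fun x => (⟨x, X x⟩ : TangentBundle 𝓘(ℝ, E) M)) p := by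
  have h1 : ContMDiffAt 𝓘(ℝ, E) 𝓘(ℝ, E × E) ∞ (fun q => (e q, fieldCoord e X (e q))) p :=
    (contMDiffAt_of_mem_maximalAtlas he hp).prodMk_space
      (hX.contMDiffAt.comp p (contMDiffAt_of_mem_maximalAtlas he hp))
  have h2 := ContMDiffAt.comp p (contMDiffAt_tangentCoordSymm he
    (z := (e p, fieldCoord e X (e p))) (e.map_source hp)) h1
  refine h2.congr_of_eventuallyEq ?_
  filter_upwards [e.open_source.mem_nhds hp] with q hq
  rw [Function.comp_apply, fieldCoord_apply hq]
  exact (tangentCoordSymm_tangentCoord he (v := ⟨q, X q⟩) hq).symm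

theorem smoothNear_iff {p : M} (hp : p ∈ e.source) (X : VField E M) :
    SmoothNear X p ↔ ∀ᶠ x in 𝓝 (e p), ContDiffAt ℝ ∞ (fieldCoord e X) x := by
  constructor
  · intro h
    filter_upwards [(e.tendsto_symm hp).eventually h,
      e.open_target.mem_nhds (e.map_source hp)] with x hx hx'
    simpa [e.right_inv hx'] using contDiffAt_fieldCoord he (e.map_target hx') hx
  · intro h
    filter_upwards [(e.continuousAt hp).eventually h, e.open_source.mem_nhds hp] with q hq hq'
      using contMDiffAt_of_fieldCoord he hq' hq

theorem SmoothNear.contDiffAt_fieldCoord {p : M} (hp : p ∈ e.source) {X : VField E M}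
    (hX : SmoothNear X p) : ContDiffAt ℝ ∞ (fieldCoord e X) (e p) :=
  PseudoFinsler.contDiffAt_fieldCoord he hp hX.self_of_nhds

theorem smoothNear_ofFieldCoord {p : M} (hp : p ∈ e.source) {f : E → E}
    (hf : ∀ᶠ x in 𝓝 (e p), ContDiffAt ℝ ∞ f x) : SmoothNear (ofFieldCoord e f) p := by
  rw [smoothNear_iff he hp]
  filter_upwards [hf, e.open_target.mem_nhds (e.map_source hp)] with x hx hx'
  refine hx.congr_of_eventuallyEq ?_
  filter_upwards [e.open_target.mem_nhds hx'] with y hy using fieldCoord_ofFieldCoord he hy f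

end Coordinates

/-! ### The metric, its tensors and the Lie bracket in a chart -/

section Chern

variable {E : Type*} [NormedAddCommGroup E] [NormedSpace ℝ E]
  {M : Type*} [TopologicalSpace M] [ChartedSpace E M] [IsManifold 𝓘(ℝ, E) ∞ M]

theorem mlieBracket_eq_lieBracket {V W : (x : E) → TangentSpace 𝓘(ℝ, E) x} :
    VectorField.mlieBracket 𝓘(ℝ, E) V W = VectorField.lieBracket ℝ V W := by
  rw [← VectorField.mlieBracketWithin_univ, VectorField.mlieBracketWithin_eq_lieBracketWithin]
  exact VectorField.lieBracketWithin_univ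

/-- The metric function in a chart. -/
def Metric.coordL (F : Metric E M) (e : OpenPartialHomeomorph M E) (z : E × E) : ℝ :=
  F.L (tangentCoordSymm e z)

/-- The domain of the metric in a chart. -/
def Metric.coordA (F : Metric E M) (e : OpenPartialHomeomorph M E) : Set (E × E) :=
  {z | z.1 ∈ e.target ∧ tangentCoordSymm e z ∈ F.A}

/-- The anisotropic connection of the metric in a chart. -/
def Metric.covCoord (F : Metric E M) (e : OpenPartialHomeomorph M E) (z : E × E)
    (X Y : VField E M) : E :=
  fderiv ℝ (fieldCoord e Y) z.1 (fieldCoord e X z.1)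
    + christoffel (F.coordL e) z (fieldCoord e X z.1) (fieldCoord e Y z.1)

/-- `D` has the defining properties of the Levi-Civita-Chern connection at `v`. -/
structure IsChernAt (F : Metric E M) (v : TangentBundle 𝓘(ℝ, E) M)
    (D : VField E M → VField E M → TangentSpace 𝓘(ℝ, E) v.proj) : Prop where
  torsion_free : ∀ X Y : VField E M, SmoothNear X v.proj → SmoothNear Y v.proj →
    D X Y - D Y X = VectorField.mlieBracket 𝓘(ℝ, E) X Y v.proj
  compatible : ∀ V X Y Z : VField E M,
    SmoothNear V v.proj → SmoothNear X v.proj → SmoothNear Y v.proj → SmoothNear Z v.proj →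
    V v.proj = v.2 →
    lieDeriv X (fun q => fundamentalTensor F.L ⟨q, V q⟩ (Y q) (Z q)) v.proj
      = fundamentalTensor F.L v (D X Y) (Z v.proj)
        + fundamentalTensor F.L v (Y v.proj) (D X Z)
        + 2 * cartanTensor F.L v (D X V) (Y v.proj) (Z v.proj)

/-- Uniqueness is pointwise in v: these two axioms at a single reference vector suffice, without
Leibniz rule or smoothness in v. -/
theorem IsLeviCivitaChern.isChernAt {F : Metric E M} {nabla : PreConnection E M}
    (h : IsLeviCivitaChern F nabla) {v : TangentBundle 𝓘(ℝ, E) M} (hv : v ∈ F.A) :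
    IsChernAt F v (nabla v) where
  torsion_free := h.torsion_free v hv
  compatible V X Y Z hV hX hY hZ hVv := by
    have hv' : (⟨v.proj, V v.proj⟩ : TangentBundle 𝓘(ℝ, E) M) = v := by rw [hVv]
    have := h.compatible v.proj V X Y Z hV hX hY hZ (by rwa [hv'])
    rw [hVv] at this
    exact this

variable (F : Metric E M) {e : OpenPartialHomeomorph M E}
  (he : e ∈ IsManifold.maximalAtlas 𝓘(ℝ, E) ∞ M)
include he

theorem tangentCoord_mem_coordA {v : TangentBundle 𝓘(ℝ, E) M} (hv : v ∈ F.A)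
    (hp : v.proj ∈ e.source) : tangentCoord e v ∈ F.coordA e :=
  ⟨e.map_source hp, by rwa [tangentCoordSymm_tangentCoord he hp]⟩

theorem isOpen_coordA : IsOpen (F.coordA e) :=
  (contMDiffOn_tangentCoordSymm he).continuousOn.isOpen_inter_preimage
    (e.open_target.preimage continuous_fst) F.isOpen

theorem contDiffOn_coordL : ContDiffOn ℝ ∞ (F.coordL e) (F.coordA e) :=
  (F.smooth.comp ((contMDiffOn_tangentCoordSymm he).mono fun _ hz => hz.1)
    fun _ hz => hz.2).contDiffOn

omit F [IsManifold 𝓘(ℝ, E) ∞ M] in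
theorem tangentCoordSymm_line {v : TangentBundle 𝓘(ℝ, E) M} (hp : v.proj ∈ e.source)
    (u : TangentSpace 𝓘(ℝ, E) v.proj) :
    tangentCoordSymm e (e v.proj, dcoord e v.proj u) = ⟨v.proj, u⟩ :=
  tangentCoordSymm_tangentCoord he (v := ⟨v.proj, u⟩) hp

/-- The differential of a chart is linear on each fiber, so the affine plane v + su + tw goes to an
affine plane. -/
theorem fundamentalTensor_eq {v : TangentBundle 𝓘(ℝ, E) M} (hv : v ∈ F.A)
    (hp : v.proj ∈ e.source) (u w : TangentSpace 𝓘(ℝ, E) v.proj) :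
    fundamentalTensor F.L v u w = fiberHessian (F.coordL e) (tangentCoord e v)
      (dcoord e v.proj u) (dcoord e v.proj w) := by
  refine Eq.trans ?_ (half_deriv_deriv_eq_fiberHessian (isOpen_coordA F he) (contDiffOn_coordL F he)
    (tangentCoord_mem_coordA F he hv hp) _ _)
  have h (s t : ℝ) : F.coordL e (e v.proj, dcoord e v.proj v.2
      + s • dcoord e v.proj u + t • dcoord e v.proj w)
      = F.L ⟨v.proj, v.2 + s • u + t • w⟩ := by
    rw [Metric.coordL, ← tangentCoordSymm_line he hp]
    simp only [map_add, map_smul]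
  simp only [fundamentalTensor, ← h]
  rfl

theorem isLocalMetric_coord : IsLocalMetric (F.coordL e) (F.coordA e) where
  isOpen := isOpen_coordA F he
  contDiffOn := contDiffOn_coordL F he
  conic z hz c hc := by
    refine ⟨hz.1, ?_⟩
    have := F.conic _ hz.2 c hc
    rwa [tangentCoordSymm, ← map_smul] at this
  homogeneous z hz c hc := by
    have := F.homogeneous _ hz.2 c hc
    rw [Metric.coordL, Metric.coordL, ← this, tangentCoordSymm, tangentCoordSymm, map_smul]
  nondegenerate z hz a ha := by
    have hs : (tangentCoordSymm e z).proj ∈ e.source := e.map_target hz.1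
    let b : TangentSpace 𝓘(ℝ, E) (tangentCoordSymm e z).proj := dcoordSymm e z.1 a
    have hb : dcoord e (tangentCoordSymm e z).proj b = a := dcoord_dcoordSymm he hz.1 a
    have h1 := F.nondegenerate _ hz.2 b fun w => by
      rw [fundamentalTensor_eq F he hz.2 hs, tangentCoord_tangentCoordSymm he hz.1, hb, ha]
    rw [← hb, h1, map_zero]

theorem cartanTensor_eq {v : TangentBundle 𝓘(ℝ, E) M} (hv : v ∈ F.A)
    (hp : v.proj ∈ e.source) (u w z : TangentSpace 𝓘(ℝ, E) v.proj) :
    2 * cartanTensor F.L v u w z = verticalDeriv (F.coordL e) (tangentCoord e v)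
      (dcoord e v.proj u) (dcoord e v.proj w)
      (dcoord e v.proj z) := by
  have hm := isLocalMetric_coord F he
  have hvA := tangentCoord_mem_coordA F he hv hp
  have hline (t : ℝ) : tangentCoord e ⟨v.proj, v.2 + t • z⟩ = ((tangentCoord e v).1,
      (tangentCoord e v).2 + t • (dcoord e v.proj z : E)) := by
    simp only [tangentCoord, map_add, map_smul]
  have h1 := hm.hasDerivAt_fiberHessian_vertical hvA (dcoord e v.proj u)
    (dcoord e v.proj w) (dcoord e v.proj z)
  have h2 : (fun t : ℝ => fundamentalTensor F.L ⟨v.proj, v.2 + t • z⟩ u w) =ᶠ[𝓝 0] fun t =>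
      fiberHessian (F.coordL e) ((tangentCoord e v).1,
      (tangentCoord e v).2 + t • (dcoord e v.proj z : E))
      (dcoord e v.proj u) (dcoord e v.proj w) := by
    filter_upwards [eventually_vertical_mem hm.isOpen hvA
      (dcoord e v.proj z)] with t ht
    rw [← hline] at ht ⊢
    have := ht.2
    rw [tangentCoordSymm_tangentCoord he (v := ⟨v.proj, v.2 + t • z⟩) hp] at this
    exact fundamentalTensor_eq F he this hp u w
  rw [cartanTensor, h2.deriv_eq, h1.deriv, hm.verticalDeriv_swap hvA, hm.verticalDeriv_comm hvA]
  ring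

omit F [IsManifold 𝓘(ℝ, E) ∞ M] in
theorem lieDeriv_eq {p : M} (hp : p ∈ e.source) {f : M → ℝ}
    (hf : DifferentiableAt ℝ (f ∘ e.symm) (e p)) (X : VField E M) :
    lieDeriv X f p = fderiv ℝ (f ∘ e.symm) (e p) (fieldCoord e X (e p)) := by
  have h1 : f =ᶠ[𝓝 p] (f ∘ e.symm) ∘ e := by
    filter_upwards [e.open_source.mem_nhds hp] with q hq
    simp [e.left_inv hq]
  have h2 := (mdifferentiable_of_mem_maximalAtlas he).mdifferentiableAt hp
  rw [lieDeriv, h1.mfderiv_eq, mfderiv_comp (I' := 𝓘(ℝ, E)) p hf.mdifferentiableAt h2,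
    fieldCoord_apply hp, mfderiv_eq_fderiv]
  rfl

variable [FiniteDimensional ℝ E]

omit F in
-- Naturality of the bracket under pullback by `e.symm`.
theorem mfderiv_mlieBracket {p : M} (hp : p ∈ e.source) {X Y : VField E M}
    (hX : SmoothNear X p) (hY : SmoothNear Y p) :
    dcoord e p (VectorField.mlieBracket 𝓘(ℝ, E) X Y p)
      = VectorField.lieBracket ℝ (fieldCoord e X) (fieldCoord e Y) (e p) := by
  have : CompleteSpace E := FiniteDimensional.complete ℝ E
  have : IsManifold 𝓘(ℝ, E) (minSmoothness ℝ 2) M :=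
    IsManifold.of_le (n := ∞) minSmoothness_two_le
  have : IsManifold 𝓘(ℝ, E) (minSmoothness ℝ 2) E :=
    IsManifold.of_le (n := ∞) minSmoothness_two_le
  have ht := e.map_source hp
  have hd {X : VField E M} (hX : SmoothNear X p) :
      MDifferentiableAt 𝓘(ℝ, E) 𝓘(ℝ, E).tangent
        (fun x => (⟨x, X x⟩ : TangentBundle 𝓘(ℝ, E) M)) (e.symm (e p)) := by
    rw [e.left_inv hp]; exact hX.self_of_nhds.mdifferentiableAt (by simp)
  have hpull (X : VField E M) : ∀ x ∈ e.target,
      VectorField.mpullback 𝓘(ℝ, E) 𝓘(ℝ, E) e.symm X x = fieldCoord e X x := by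
    intro x hx
    have h : mfderiv 𝓘(ℝ, E) 𝓘(ℝ, E) e.symm x
      = ((mdifferentiable_of_mem_maximalAtlas he).symm.mfderiv hx : _ →L[ℝ] _) := rfl
    rw [VectorField.mpullback_apply, h, ContinuousLinearMap.inverse_equiv]
    rfl
  have h1 := VectorField.mpullback_mlieBracket (I := 𝓘(ℝ, E)) (n := ∞) (hd hX) (hd hY)
    (contMDiffAt_symm_of_mem_maximalAtlas he ht) minSmoothness_two_le
  rw [hpull _ _ ht, fieldCoord_apply hp] at h1
  rw [h1]
  have h2 (X : VField E M) : VectorField.mpullback 𝓘(ℝ, E) 𝓘(ℝ, E) e.symm X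
      =ᶠ[𝓝 (e p)] fieldCoord e X := by
    filter_upwards [e.open_target.mem_nhds ht] with x hx using hpull X x hx
  rw [Filter.EventuallyEq.mlieBracket_vectorField_eq (h2 X) (h2 Y)]
  exact congrFun mlieBracket_eq_lieBracket _

end Chern

/-! ### Existence and uniqueness of the Levi-Civita-Chern connection -/

section Existence

variable {E : Type*} [NormedAddCommGroup E] [NormedSpace ℝ E] [FiniteDimensional ℝ E]
  {M : Type*} [TopologicalSpace M] [ChartedSpace E M] [IsManifold 𝓘(ℝ, E) ∞ M]
  (F : Metric E M) {e : OpenPartialHomeomorph M E}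
  (he : e ∈ IsManifold.maximalAtlas 𝓘(ℝ, E) ∞ M)
include he

/-- The left side of almost compatibility does not involve the connection, so this one computation
serves both existence and uniqueness. -/
theorem lieDeriv_fundamentalTensor {v : TangentBundle 𝓘(ℝ, E) M} (hv : v ∈ F.A)
    (hp : v.proj ∈ e.source) {V X Y Z : VField E M} (hV : SmoothNear V v.proj)
    (hY : SmoothNear Y v.proj) (hZ : SmoothNear Z v.proj)
    (hVv : V v.proj = v.2) :
    lieDeriv X (fun q => fundamentalTensor F.L ⟨q, V q⟩ (Y q) (Z q)) v.proj
      = fiberHessian (F.coordL e) (tangentCoord e v) (F.covCoord e (tangentCoord e v) X Y)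
          (dcoord e v.proj (Z v.proj))
        + fiberHessian (F.coordL e) (tangentCoord e v) (dcoord e v.proj (Y v.proj))
          (F.covCoord e (tangentCoord e v) X Z)
        + verticalDeriv (F.coordL e) (tangentCoord e v) (F.covCoord e (tangentCoord e v) X V)
          (dcoord e v.proj (Y v.proj)) (dcoord e v.proj (Z v.proj)) := by
  have hm := isLocalMetric_coord F he
  have ht := e.map_source hp
  have hz : tangentCoord e v = (e v.proj, fieldCoord e V (e v.proj)) := by
    rw [fieldCoord_apply hp, hVv]; rfl
  have hzA := tangentCoord_mem_coordA F he hv hp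
  have hdV := (SmoothNear.contDiffAt_fieldCoord he hp hV).differentiableAt (by simp)
  have hdY := (SmoothNear.contDiffAt_fieldCoord he hp hY).differentiableAt (by simp)
  have hdZ := (SmoothNear.contDiffAt_fieldCoord he hp hZ).differentiableAt (by simp)
  rw [hz] at hzA
  have hmem : ∀ᶠ x in 𝓝 (e v.proj), (x, fieldCoord e V x) ∈ F.coordA e :=
    (continuousAt_id.prodMk hdV.continuousAt).eventually (hm.isOpen.mem_nhds hzA)
  have hloc : (fun q => fundamentalTensor F.L ⟨q, V q⟩ (Y q) (Z q)) ∘ e.symm =ᶠ[𝓝 (e v.proj)]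
      fun x => fiberHessian (F.coordL e) (x, fieldCoord e V x) (fieldCoord e Y x)
        (fieldCoord e Z x) := by
    filter_upwards [hmem, e.open_target.mem_nhds ht] with x hx hxt
    have hc : tangentCoord e ⟨e.symm x, V (e.symm x)⟩ = (x, fieldCoord e V x) :=
      Prod.ext (e.right_inv hxt) rfl
    have hA : (⟨e.symm x, V (e.symm x)⟩ : TangentBundle 𝓘(ℝ, E) M) ∈ F.A := by
      have := hx.2
      rwa [← hc, tangentCoordSymm_tangentCoord he (v := ⟨e.symm x, V (e.symm x)⟩)
        (e.map_target hxt)] at this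
    rw [Function.comp_apply, fundamentalTensor_eq F he hA (e.map_target hxt), hc]
    rfl
  have hd : DifferentiableAt ℝ (fun x => fiberHessian (F.coordL e) (x, fieldCoord e V x)
      (fieldCoord e Y x) (fieldCoord e Z x)) (e v.proj) :=
    ((DifferentiableAt.comp (e v.proj) (hm.hasFDerivAt_fiberHessian hzA).differentiableAt
      (differentiableAt_id.prodMk hdV)).clm_apply hdY).clm_apply hdZ
  rw [lieDeriv_eq he hp (hd.congr_of_eventuallyEq hloc), hloc.fderiv_eq,
    hm.fderiv_fiberHessian_fields hzA hdV hdY hdZ, hz]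
  simp only [Metric.covCoord, fieldCoord_apply hp]

/-- The formula in a chart satisfies the axioms of the Levi-Civita-Chern connection. -/
theorem isChernAt_covCoord {v : TangentBundle 𝓘(ℝ, E) M} (hv : v ∈ F.A)
    (hp : v.proj ∈ e.source) :
    IsChernAt F v fun X Y => (dcoord e v.proj).inverse (F.covCoord e (tangentCoord e v) X Y) where
  torsion_free X Y hX hY := by
    refine dcoord_injective he hp ?_
    rw [map_sub, dcoord_inverse he hp, dcoord_inverse he hp]
    refine Eq.trans ?_ (mfderiv_mlieBracket he hp hX hY).symm
    rw [VectorField.lieBracket, Metric.covCoord, Metric.covCoord,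
      (isLocalMetric_coord F he).christoffel_swap (tangentCoord_mem_coordA F he hv hp)]
    simp only [tangentCoord]
    abel
  compatible V X Y Z hV hX hY hZ hVv := by
    rw [lieDeriv_fundamentalTensor F he hv hp hV hY hZ hVv, fundamentalTensor_eq F he hv hp,
      fundamentalTensor_eq F he hv hp, cartanTensor_eq F he hv hp, dcoord_inverse he hp,
      dcoord_inverse he hp, dcoord_inverse he hp]

/-- The axioms of the Levi-Civita-Chern connection determine it. -/
theorem IsChernAt.dcoord_eq {F : Metric E M} {v : TangentBundle 𝓘(ℝ, E) M} (hv : v ∈ F.A)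
    (hp : v.proj ∈ e.source) {D : VField E M → VField E M → TangentSpace 𝓘(ℝ, E) v.proj}
    (hD : IsChernAt F v D) {X Y : VField E M} (hX : SmoothNear X v.proj)
    (hY : SmoothNear Y v.proj) :
    dcoord e v.proj (D X Y) = F.covCoord e (tangentCoord e v) X Y := by
  have hm := isLocalMetric_coord F he
  have hzA := tangentCoord_mem_coordA F he hv hp
  have hD' := isChernAt_covCoord F he hv hp
  -- Fields with constant coordinates realize every tangent vector.
  have hsurj (a : E) : ∃ W : VField E M, SmoothNear W v.proj ∧ dcoord e v.proj (W v.proj) = a :=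
    ⟨ofFieldCoord e fun _ => a,
      smoothNear_ofFieldCoord he hp (.of_forall fun _ => contDiffAt_const),
      by rw [ofFieldCoord, dcoord_inverse he hp]⟩
  obtain ⟨W, hW, hWv⟩ := hsurj (dcoord e v.proj v.2)
  have hWv' : W v.proj = v.2 := dcoord_injective he hp hWv
  rw [← sub_eq_zero]
  -- Indexing by vector fields, not by their values, avoids having to know beforehand that the
  -- difference of the two connections is tensorial.
  refine eq_zero_of_symmetric_of_compatible (ι := {X : VField E M // SmoothNear X v.proj})
    (g := fiberHessian (F.coordL e) (tangentCoord e v))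
    (T := verticalDeriv (F.coordL e) (tangentCoord e v)) (v := dcoord e v.proj v.2)
    (hm.fiberHessian_comm hzA) (hm.nondegenerate _ hzA) (hm.verticalDeriv_comm hzA)
    (hm.verticalDeriv_radial hzA) (fun X => dcoord e v.proj (X.1 v.proj))
    (fun a => ?_) (fun X Y => dcoord e v.proj (D X.1 Y.1)
      - F.covCoord e (tangentCoord e v) X.1 Y.1) (fun X Y => ?_) ⟨W, hW⟩ hWv (fun X Y Z => ?_)
    ⟨X, hX⟩ ⟨Y, hY⟩
  · obtain ⟨W, hW, hWa⟩ := hsurj a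
    exact ⟨⟨W, hW⟩, hWa⟩
  · have h1 := hD.torsion_free X.1 Y.1 X.2 Y.2
    rw [← hD'.torsion_free X.1 Y.1 X.2 Y.2] at h1
    have h2 := congrArg (dcoord e v.proj) h1
    rw [map_sub, map_sub, dcoord_inverse he hp, dcoord_inverse he hp] at h2
    rw [sub_eq_sub_iff_add_eq_add] at h2 ⊢
    rw [h2, add_comm]
  · have h1 := hD.compatible W X.1 Y.1 Z.1 hW X.2 Y.2 Z.2 hWv'
    rw [lieDeriv_fundamentalTensor F he hv hp hW Y.2 Z.2 hWv', fundamentalTensor_eq F he hv hp,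
      fundamentalTensor_eq F he hv hp, cartanTensor_eq F he hv hp] at h1
    simp only [map_sub, sub_apply]
    linarith

omit [FiniteDimensional ℝ E] [IsManifold 𝓘(ℝ, E) ∞ M] in
theorem FunSmoothNear.contDiffAt_comp_symm {p : M} (hp : p ∈ e.source) {f : M → ℝ}
    (hf : FunSmoothNear E f p) : ContDiffAt ℝ ∞ (f ∘ e.symm) (e p) := by
  have h1 : ContMDiffAt 𝓘(ℝ, E) 𝓘(ℝ, E) ∞ e.symm (e p) :=
    contMDiffAt_symm_of_mem_maximalAtlas he (e.map_source hp)
  have h2 := hf.self_of_nhds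
  rw [← e.left_inv hp] at h2
  exact (h2.comp (e p) h1).contDiffAt

theorem contDiffAt_covCoord {z : E × E} (hz : z ∈ F.coordA e) {X Y : VField E M}
    (hX : ContDiffAt ℝ ∞ (fieldCoord e X) z.1) (hY : ContDiffAt ℝ ∞ (fieldCoord e Y) z.1) :
    ContDiffAt ℝ ∞ (fun z => F.covCoord e z X Y) z := by
  have hm := isLocalMetric_coord F he
  have hX' : ContDiffAt ℝ ∞ (fun z : E × E => fieldCoord e X z.1) z := hX.comp z contDiffAt_fst
  have hY' : ContDiffAt ℝ ∞ (fun z : E × E => fieldCoord e Y z.1) z := hY.comp z contDiffAt_fst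
  have hdY : ContDiffAt ℝ ∞ (fun z : E × E => fderiv ℝ (fieldCoord e Y) z.1) z :=
    (hY.fderiv_right (by simp)).comp z contDiffAt_fst
  exact (hdY.clm_apply hX').add
    (((hm.contDiffOn_christoffel.contDiffAt (hm.isOpen.mem_nhds hz)).clm_apply hX').clm_apply hY')

omit he in
-- The preferred chart at the base point gives a global definition. That chart may jump with v, so
-- smoothness in v rests on uniqueness, which makes the formula independent of the chart.
theorem isLeviCivitaChern_chartAt : IsLeviCivitaChern F fun v X Y =>
    (dcoord (chartAt E v.proj) v.proj).inverse
      (F.covCoord (chartAt E v.proj) (tangentCoord (chartAt E v.proj) v) X Y) where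
  add_right v hv X Y Z hX hY hZ := by
    have he := IsManifold.chart_mem_maximalAtlas (I := 𝓘(ℝ, E)) (n := ∞) v.proj
    have hp := mem_chart_source E v.proj
    set e := chartAt E v.proj
    have hdY := (SmoothNear.contDiffAt_fieldCoord he hp hY).differentiableAt (by simp)
    have hdZ := (SmoothNear.contDiffAt_fieldCoord he hp hZ).differentiableAt (by simp)
    have h1 : fieldCoord e (fun q => Y q + Z q) = fieldCoord e Y + fieldCoord e Z := by
      funext x; simp [fieldCoord]
    rw [← map_add]
    congr 1
    simp only [Metric.covCoord, h1, tangentCoord, Pi.add_apply, map_add]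
    rw [fderiv_add hdY hdZ, add_apply]
    abel
  leibniz v hv f X Y hf hX hY := by
    have he := IsManifold.chart_mem_maximalAtlas (I := 𝓘(ℝ, E)) (n := ∞) v.proj
    have hp := mem_chart_source E v.proj
    set e := chartAt E v.proj
    have hdY := (SmoothNear.contDiffAt_fieldCoord he hp hY).differentiableAt (by simp)
    have hdf := (FunSmoothNear.contDiffAt_comp_symm he hp hf).differentiableAt (by simp)
    have h1 : fieldCoord e (fun q => f q • Y q) = (f ∘ e.symm) • fieldCoord e Y := by
      funext x; simp [fieldCoord]
    refine dcoord_injective he hp ?_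
    rw [map_add, map_smul, map_smul, dcoord_inverse he hp, dcoord_inverse he hp,
      lieDeriv_eq he hp hdf]
    simp only [Metric.covCoord, h1, tangentCoord, Pi.smul_apply', map_smul]
    rw [fderiv_smul hdf hdY]
    simp [e.left_inv hp, fieldCoord_apply hp]
    abel
  smooth v hv X Y hX hY := by
    have he := IsManifold.chart_mem_maximalAtlas (I := 𝓘(ℝ, E)) (n := ∞) v.proj
    have hp := mem_chart_source E v.proj
    set e := chartAt E v.proj
    have hzA := tangentCoord_mem_coordA F he hv hp
    have hpr :=
      (FiberBundle.continuous_proj E (TangentSpace 𝓘(ℝ, E) (M := M))).continuousAt (x := v)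
    have h1 := contDiffAt_covCoord F he hzA (SmoothNear.contDiffAt_fieldCoord he hp hX)
      (SmoothNear.contDiffAt_fieldCoord he hp hY)
    have h2 : ContDiffAt ℝ ∞ (fun z => (z.1, F.covCoord e z X Y)) (tangentCoord e v) :=
      contDiffAt_fst.prodMk h1
    have h3 := h2.contMDiffAt.comp v (contMDiffAt_tangentCoord he hp)
    have h4 := ContMDiffAt.comp v (contMDiffAt_tangentCoordSymm he
      (z := ((tangentCoord e v).1, F.covCoord e (tangentCoord e v) X Y)) (e.map_source hp)) h3
    refine h4.congr_of_eventuallyEq ?_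
    filter_upwards [F.isOpen.mem_nhds hv, hpr.eventually (e.open_source.mem_nhds hp),
      hpr.eventually hX.eventually_nhds, hpr.eventually hY.eventually_nhds] with w hw hws hwX hwY
    -- The value at w is defined in the chart at w's own base point; uniqueness rewrites it in the
    -- fixed chart `e`.
    have h5 := IsChernAt.dcoord_eq he hw hws (isChernAt_covCoord F
      (IsManifold.chart_mem_maximalAtlas (I := 𝓘(ℝ, E)) (n := ∞) w.proj) hw
      (mem_chart_source E w.proj)) hwX hwY
    simp only [Function.comp_apply, ← h5]
    exact (tangentCoordSymm_line he hws _).symm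
  linear_left v hv f h X Y Z hf hh hX hY hZ := by
    have he := IsManifold.chart_mem_maximalAtlas (I := 𝓘(ℝ, E)) (n := ∞) v.proj
    have hp := mem_chart_source E v.proj
    set e := chartAt E v.proj
    rw [← map_smul, ← map_smul, ← map_add]
    congr 1
    simp only [Metric.covCoord, tangentCoord, fieldCoord_apply hp, map_add, map_smul,
      add_apply, smul_apply, smul_add]
    abel
  torsion_free v hv := (isChernAt_covCoord F
    (IsManifold.chart_mem_maximalAtlas (I := 𝓘(ℝ, E)) (n := ∞) v.proj) hv
    (mem_chart_source E v.proj)).torsion_free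
  compatible p V X Y Z hV hX hY hZ hA := (isChernAt_covCoord F
    (IsManifold.chart_mem_maximalAtlas (I := 𝓘(ℝ, E)) (n := ∞) p) hA
    (mem_chart_source E p)).compatible V X Y Z hV hX hY hZ rfl

omit he in
-- Existence is what gives the `Classical.epsilon` in `Metric.chern` its defining property.
theorem isLeviCivitaChern_chern : IsLeviCivitaChern F F.chern :=
  Classical.epsilon_spec ⟨_, isLeviCivitaChern_chartAt F⟩

/-- The Levi-Civita-Chern connection in a chart. -/
theorem dcoord_chern {v : TangentBundle 𝓘(ℝ, E) M} (hv : v ∈ F.A) (hp : v.proj ∈ e.source)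
    {X Y : VField E M} (hX : SmoothNear X v.proj) (hY : SmoothNear Y v.proj) :
    dcoord e v.proj (F.chern v X Y) = F.covCoord e (tangentCoord e v) X Y :=
  IsChernAt.dcoord_eq he hv hp ((isLeviCivitaChern_chern F).isChernAt hv) hX hY

end Existence

/-! ### Smoothness of the standard extension of a vector -/

section Extend

variable {E : Type*} [NormedAddCommGroup E] [NormedSpace ℝ E]
  {M : Type*} [TopologicalSpace M] [ChartedSpace E M] [IsManifold 𝓘(ℝ, E) ∞ M]

/-- The extension is constant in the trivialization at p. -/
theorem smoothNear_extend {p : M} (u : TangentSpace 𝓘(ℝ, E) p) :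
    SmoothNear (M := M) (FiberBundle.extend E u) p := by
  set t := trivializationAt E (TangentSpace 𝓘(ℝ, E) (M := M)) p with ht
  filter_upwards [t.open_baseSet.mem_nhds (FiberBundle.mem_baseSet_trivializationAt' p)] with q hq
  rw [t.contMDiffAt_section_iff hq]
  refine contMDiffAt_const (c := (t ⟨p, u⟩).2) |>.congr_of_eventuallyEq ?_
  filter_upwards [t.open_baseSet.mem_nhds hq] with x hx
  simp [FiberBundle.extend, ← ht, hx]

end Extend

/-! ### Adapted charts and the second fundamental form in them -/

section Submanifold

variable {E : Type*} [NormedAddCommGroup E] [NormedSpace ℝ E]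
  {M : Type*} [TopologicalSpace M] [ChartedSpace E M]
  {E' : Type*} [NormedAddCommGroup E'] [NormedSpace ℝ E']
  {S : Type*} [TopologicalSpace S] [ChartedSpace E' S]

/-- In the charts `φ` of `S` and `ψ` of `M`, the map `i` is the linear map `ι`, which has the linear
retraction `ρ`. -/
structure IsAdapted (i : S → M) (φ : OpenPartialHomeomorph S E') (ψ : OpenPartialHomeomorph M E)
    (ι : E' →L[ℝ] E) (ρ : E →L[ℝ] E') : Prop where
  dom_mem : φ ∈ IsManifold.maximalAtlas 𝓘(ℝ, E') ∞ S
  cod_mem : ψ ∈ IsManifold.maximalAtlas 𝓘(ℝ, E) ∞ M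
  mapsTo : ∀ q ∈ φ.source, i q ∈ ψ.source
  eq_linear : ∀ q ∈ φ.source, ψ (i q) = ι (φ q)
  retraction : ∀ x, ρ (ι x) = x

/-- The definition of an immersion provides charts in which i is x ↦ (x,0) up to a linear
equivalence; ι is that map and ρ the first projection after the inverse equivalence. -/
theorem exists_isAdapted {i : S → M} (hi : Manifold.IsImmersion 𝓘(ℝ, E') 𝓘(ℝ, E) ∞ i) (p : S) :
    ∃ φ ψ ι ρ, IsAdapted (E := E) (E' := E') i φ ψ ι ρ ∧ p ∈ φ.source := by
  have h := hi.isImmersionAt p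
  refine ⟨h.domChart, h.codChart,
    (h.equiv : E' × h.complement →L[ℝ] E).comp (ContinuousLinearMap.inl ℝ E' h.complement),
    (ContinuousLinearMap.fst ℝ E' h.complement).comp (h.equiv.symm : E →L[ℝ] E' × h.complement),
    ⟨h.domChart_mem_maximalAtlas, h.codChart_mem_maximalAtlas,
      fun q hq => h.source_subset_preimage_source hq, fun q hq => ?_, fun x => ?_⟩,
    h.mem_domChart_source⟩
  · have hmem : h.domChart q ∈ (h.domChart.extend 𝓘(ℝ, E')).target := by
      simpa using h.domChart.map_source hq
    have := h.writtenInCharts hmem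
    simpa [h.domChart.left_inv hq] using this
  · simp

namespace IsAdapted

variable {i : S → M} {φ : OpenPartialHomeomorph S E'} {ψ : OpenPartialHomeomorph M E}
  {ι : E' →L[ℝ] E} {ρ : E →L[ℝ] E'} (h : IsAdapted i φ ψ ι ρ)
include h

theorem mdifferentiableAt {q : S} (hq : q ∈ φ.source) :
    MDifferentiableAt 𝓘(ℝ, E') 𝓘(ℝ, E) i q := by
  have hφ := mdifferentiable_of_mem_maximalAtlas h.dom_mem
  have hψ := mdifferentiable_of_mem_maximalAtlas h.cod_mem
  have h1 : i =ᶠ[𝓝 q] ψ.symm ∘ ι ∘ φ := by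
    filter_upwards [φ.open_source.mem_nhds hq] with x hx
    simp only [Function.comp_apply]
    rw [← h.eq_linear x hx, ψ.left_inv (h.mapsTo x hx)]
  refine MDifferentiableAt.congr_of_eventuallyEq ?_ h1
  have ht : ι (φ q) ∈ ψ.target := by
    rw [← h.eq_linear q hq]; exact ψ.map_source (h.mapsTo q hq)
  exact MDifferentiableAt.comp (I' := 𝓘(ℝ, E)) q (hψ.mdifferentiableAt_symm ht)
    (MDifferentiableAt.comp (I' := 𝓘(ℝ, E')) q ι.mdifferentiableAt (hφ.mdifferentiableAt hq))

theorem dcoord_diff {q : S} (hq : q ∈ φ.source) (u : TangentSpace 𝓘(ℝ, E') q) :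
    dcoord ψ (i q) (diff E E' i q u) = ι (dcoord φ q u) := by
  have hφ := mdifferentiable_of_mem_maximalAtlas h.dom_mem
  have hψ := mdifferentiable_of_mem_maximalAtlas h.cod_mem
  have h1 : ψ ∘ i =ᶠ[𝓝 q] ι ∘ φ := by
    filter_upwards [φ.open_source.mem_nhds hq] with x hx using h.eq_linear x hx
  have h2 := h1.mfderiv_eq (I := 𝓘(ℝ, E')) (I' := 𝓘(ℝ, E))
  rw [mfderiv_comp (I' := 𝓘(ℝ, E)) q (hψ.mdifferentiableAt (h.mapsTo q hq))
    (h.mdifferentiableAt hq), mfderiv_comp (I' := 𝓘(ℝ, E')) q ι.mdifferentiableAt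
      (hφ.mdifferentiableAt hq)] at h2
  have h3 : mfderiv 𝓘(ℝ, E') 𝓘(ℝ, E) ι (φ q) = ι := ι.mfderiv_eq
  rw [h3] at h2
  exact congrArg (fun f : E' →L[ℝ] E => f u) h2

theorem tangentCoord_push {v : TangentBundle 𝓘(ℝ, E') S} (hv : v.proj ∈ φ.source) :
    tangentCoord ψ (push E i v) = ι.prodMap ι (tangentCoord φ v) :=
  Prod.ext (h.eq_linear _ hv) (h.dcoord_diff hv v.2)

theorem push_tangentCoordSymm {z : E' × E'} (hz : z.1 ∈ φ.target) :
    push E i (tangentCoordSymm φ z) = tangentCoordSymm ψ (ι.prodMap ι z) := by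
  have hs : (tangentCoordSymm φ z).proj ∈ φ.source := φ.map_target hz
  rw [← tangentCoord_tangentCoordSymm h.dom_mem hz, ← h.tangentCoord_push hs,
    tangentCoordSymm_tangentCoord h.cod_mem (h.mapsTo _ hs),
    tangentCoord_tangentCoordSymm h.dom_mem hz]

theorem retraction_eventually {p : S} (hp : p ∈ φ.source) {P : E' → Prop}
    (hP : ∀ᶠ x in 𝓝 (φ p), P x) : ∀ᶠ y in 𝓝 (ψ (i p)), P (ρ y) := by
  refine ρ.continuous.continuousAt.eventually ?_
  rwa [h.eq_linear p hp, h.retraction]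

variable [IsManifold 𝓘(ℝ, E) ∞ M] [IsManifold 𝓘(ℝ, E') ∞ S]

/-- In coordinates the field is extended to be constant along the fibers of ρ. -/
theorem exists_isExtension {p : S} (hp : p ∈ φ.source) {X : VField E' S} (hX : SmoothNear X p) :
    ∃ X' : VField E M, IsExtension i p X X' := by
  refine ⟨ofFieldCoord ψ fun y => ι (fieldCoord φ X (ρ y)),
    smoothNear_ofFieldCoord h.cod_mem (h.mapsTo p hp) ?_, ?_⟩
  · filter_upwards [h.retraction_eventually hp ((smoothNear_iff h.dom_mem hp X).1 hX)] with y hy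
    exact ι.contDiff.contDiffAt.comp y (hy.comp y ρ.contDiff.contDiffAt)
  · filter_upwards [φ.open_source.mem_nhds hp] with q hq
    refine dcoord_injective h.cod_mem (h.mapsTo q hq) ?_
    rw [ofFieldCoord, dcoord_inverse h.cod_mem (h.mapsTo q hq), h.dcoord_diff hq,
      h.eq_linear q hq, h.retraction, fieldCoord_apply hq]

theorem isExtension_someExtension {p : S} (hp : p ∈ φ.source) {X : VField E' S}
    (hX : SmoothNear X p) : IsExtension i p X (someExtension (E := E) i p X) :=
  Classical.epsilon_spec (h.exists_isExtension hp hX)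

omit [IsManifold 𝓘(ℝ, E') ∞ S] in
theorem fieldCoord_extension_eventuallyEq {p : S} (hp : p ∈ φ.source) {X : VField E' S}
    {X' : VField E M} (hX' : IsExtension i p X X') :
    fieldCoord ψ X' ∘ ι =ᶠ[𝓝 (φ p)] ι ∘ fieldCoord φ X := by
  filter_upwards [(φ.tendsto_symm hp).eventually hX'.2,
    φ.open_target.mem_nhds (φ.map_source hp)] with x hx hxt
  have hs := φ.map_target hxt
  have h1 : ι x = ψ (i (φ.symm x)) := by rw [h.eq_linear _ hs, φ.right_inv hxt]
  rw [Function.comp_apply, h1, fieldCoord_apply (h.mapsTo _ hs), hx, h.dcoord_diff hs]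
  rfl

omit [IsManifold 𝓘(ℝ, E') ∞ S] in
theorem fieldCoord_extension {p : S} (hp : p ∈ φ.source) {X : VField E' S}
    {X' : VField E M} (hX' : IsExtension i p X X') :
    fieldCoord ψ X' (ι (φ p)) = ι (fieldCoord φ X (φ p)) :=
  (h.fieldCoord_extension_eventuallyEq hp hX').eq_of_nhds

/-- Derivatives in directions tangent to S see only the values on S. Hence the ambient derivative
does not depend on the extension, and its differentiation term is tangent to S. -/
theorem fderiv_fieldCoord_extension {p : S} (hp : p ∈ φ.source) {X : VField E' S}
    (hX : SmoothNear X p) {X' : VField E M} (hX' : IsExtension i p X X') (a : E') :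
    fderiv ℝ (fieldCoord ψ X') (ι (φ p)) (ι a) = ι (fderiv ℝ (fieldCoord φ X) (φ p) a) := by
  have h1 := (SmoothNear.contDiffAt_fieldCoord h.cod_mem (h.mapsTo p hp) hX'.1).differentiableAt
    (by simp)
  rw [h.eq_linear p hp] at h1
  have h2 := (SmoothNear.contDiffAt_fieldCoord h.dom_mem hp hX).differentiableAt (by simp)
  have h3 := (h.fieldCoord_extension_eventuallyEq hp hX').fderiv_eq (𝕜 := ℝ)
  rw [fderiv_comp _ h1 ι.differentiableAt, fderiv_comp _ ι.differentiableAt h2, ι.fderiv,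
    ι.fderiv] at h3
  exact congrArg (fun f : E' →L[ℝ] E => f a) h3

variable (F : Metric E M)

theorem covCoord_extension {v : TangentBundle 𝓘(ℝ, E') S} (hv : v.proj ∈ φ.source)
    {X Y : VField E' S} (hY : SmoothNear Y v.proj) {X' Y' : VField E M}
    (hX' : IsExtension i v.proj X X') (hY' : IsExtension i v.proj Y Y') :
    F.covCoord ψ (tangentCoord ψ (push E i v)) X' Y'
      = ι (fderiv ℝ (fieldCoord φ Y) (φ v.proj) (dcoord φ v.proj (X v.proj)))
        + christoffel (F.coordL ψ) (ι.prodMap ι (tangentCoord φ v))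
          (ι (dcoord φ v.proj (X v.proj))) (ι (dcoord φ v.proj (Y v.proj))) := by
  rw [h.tangentCoord_push hv, Metric.covCoord]
  have h1 : (ι.prodMap ι (tangentCoord φ v)).1 = ι (φ v.proj) := rfl
  rw [h1, h.fieldCoord_extension hv hX', h.fieldCoord_extension hv hY',
    h.fderiv_fieldCoord_extension hv hY hY', fieldCoord_apply hv, fieldCoord_apply hv]

variable [FiniteDimensional ℝ E]

theorem dcoord_ambient {v : TangentBundle 𝓘(ℝ, E') S} (hv : v.proj ∈ φ.source)
    (hA : push E i v ∈ F.A) {X Y : VField E' S} (hX : SmoothNear X v.proj)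
    (hY : SmoothNear Y v.proj) :
    dcoord ψ (i v.proj) (F.ambient i v X Y)
      = ι (fderiv ℝ (fieldCoord φ Y) (φ v.proj) (dcoord φ v.proj (X v.proj)))
        + christoffel (F.coordL ψ) (ι.prodMap ι (tangentCoord φ v))
          (ι (dcoord φ v.proj (X v.proj))) (ι (dcoord φ v.proj (Y v.proj))) := by
  have hX' := h.isExtension_someExtension hv hX
  have hY' := h.isExtension_someExtension hv hY
  rw [← h.covCoord_extension F hv hY hX' hY']
  exact dcoord_chern F h.cod_mem (v := push E i v) hA (h.mapsTo _ hv) hX'.1 hY'.1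

omit [FiniteDimensional ℝ E] [IsManifold 𝓘(ℝ, E') ∞ S] in
-- The vector t witnesses that the choice in `Metric.tangentPart` has its defining property;
-- non-degeneracy of g_v on the tangent space of S then forces the chosen vector to be t.
theorem tangentPart_eq (hnd : F.IsNondegenerateAlong (E' := E') i)
    {v : TangentBundle 𝓘(ℝ, E') S} (hv : v.proj ∈ φ.source) (hA : push E i v ∈ F.A)
    {y : TangentSpace 𝓘(ℝ, E) (i v.proj)} {t : TangentSpace 𝓘(ℝ, E') v.proj}
    (ht : ∀ w, fiberHessian (F.coordL ψ) (ι.prodMap ι (tangentCoord φ v))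
      (dcoord ψ (i v.proj) y - ι (dcoord φ v.proj t)) (ι w) = 0) :
    F.tangentPart i v y = t := by
  have key (s w : TangentSpace 𝓘(ℝ, E') v.proj) :
      fundamentalTensor F.L (push E i v) (y - diff E E' i v.proj s) (diff E E' i v.proj w)
      = fiberHessian (F.coordL ψ) (ι.prodMap ι (tangentCoord φ v))
        (dcoord ψ (i v.proj) y - ι (dcoord φ v.proj s)) (ι (dcoord φ v.proj w)) := by
    rw [fundamentalTensor_eq F h.cod_mem hA (h.mapsTo _ hv), h.tangentCoord_push hv]
    have h1 : dcoord ψ (push E i v).proj (y - diff E E' i v.proj s)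
        = dcoord ψ (i v.proj) y - ι (dcoord φ v.proj s) := by
      rw [← h.dcoord_diff hv s]; exact map_sub _ _ _
    have h2 : dcoord ψ (push E i v).proj (diff E E' i v.proj w) = ι (dcoord φ v.proj w) :=
      h.dcoord_diff hv w
    rw [h1, h2]
  have hspec : ∀ w, fundamentalTensor F.L (push E i v)
      (y - diff E E' i v.proj (F.tangentPart i v y)) (diff E E' i v.proj w) = 0 :=
    Classical.epsilon_spec (p := fun t : TangentSpace 𝓘(ℝ, E') v.proj =>
      ∀ w : TangentSpace 𝓘(ℝ, E') v.proj,
        fundamentalTensor F.L (push E i v) (y - diff E E' i v.proj t) (diff E E' i v.proj w) = 0)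
      ⟨t, fun w => by rw [key, ht]⟩
  rw [← sub_eq_zero]
  refine hnd v hA _ fun w => ?_
  rw [fundamentalTensor_eq F h.cod_mem hA (h.mapsTo _ hv), h.tangentCoord_push hv]
  have h1 : dcoord ψ (push E i v).proj (diff E E' i v.proj (F.tangentPart i v y - t))
        = ι (dcoord φ v.proj (F.tangentPart i v y)) - ι (dcoord φ v.proj t) := by
    rw [← map_sub, ← map_sub]; exact h.dcoord_diff hv _
  have h2 : dcoord ψ (push E i v).proj (diff E E' i v.proj w) = ι (dcoord φ v.proj w) :=
    h.dcoord_diff hv w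
  have h3 := hspec w
  have h4 := ht (dcoord φ v.proj w)
  rw [key] at h3
  rw [h1, h2]
  rw [map_sub, sub_apply, sub_eq_zero] at h3 h4
  rw [map_sub, sub_apply, ← h3, ← h4, sub_self]

/-- The differentiation term of the ambient derivative is tangent to S, so only the Christoffel term
can contribute a normal part. -/
theorem secondForm_eq_zero_iff (hnd : F.IsNondegenerateAlong (E' := E') i)
    {v : TangentBundle 𝓘(ℝ, E') S} (hv : v.proj ∈ φ.source) (hA : push E i v ∈ F.A)
    (u w : TangentSpace 𝓘(ℝ, E') v.proj) :
    F.secondForm i v u w = 0 ↔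
      ∃ n, christoffel (F.coordL ψ) (ι.prodMap ι (tangentCoord φ v))
          (ι (dcoord φ v.proj u)) (ι (dcoord φ v.proj w)) = ι n := by
  have ha := h.dcoord_ambient F hv hA (smoothNear_extend u) (smoothNear_extend w)
  rw [FiberBundle.extend_apply_self, FiberBundle.extend_apply_self] at ha
  rw [Metric.secondForm, Metric.secondFormField, sub_eq_zero, Metric.induced]
  set y := F.ambient i v (FiberBundle.extend E' u) (FiberBundle.extend E' w)
  constructor
  · intro hy
    have h1 := congrArg (dcoord ψ (i v.proj)) hy
    rw [ha, h.dcoord_diff hv] at h1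
    refine ⟨dcoord φ v.proj (F.tangentPart i v y)
      - fderiv ℝ (fieldCoord φ (FiberBundle.extend E' w)) (φ v.proj) (dcoord φ v.proj u), ?_⟩
    rw [map_sub]
    exact eq_sub_of_add_eq' h1
  · rintro ⟨n, hn⟩
    rw [hn, ← map_add] at ha
    set m := fderiv ℝ (fieldCoord φ (FiberBundle.extend E' w)) (φ v.proj) (dcoord φ v.proj u) + n
    rw [← dcoord_inverse h.dom_mem hv m] at ha
    rw [h.tangentPart_eq F hnd hv hA (y := y) (t := (dcoord φ v.proj).inverse m)
      fun w => by rw [ha, sub_self, map_zero, zero_apply]]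
    refine dcoord_injective h.cod_mem (h.mapsTo _ hv) ?_
    rw [ha, h.dcoord_diff hv]

end IsAdapted
end Submanifold

/-! ### Consequences of the vanishing of the second fundamental form -/

section Submanifold

variable {E : Type*} [NormedAddCommGroup E] [NormedSpace ℝ E]
  {M : Type*} [TopologicalSpace M] [ChartedSpace E M]
  {E' : Type*} [NormedAddCommGroup E'] [NormedSpace ℝ E']
  {S : Type*} [TopologicalSpace S] [ChartedSpace E' S]
  [IsManifold 𝓘(ℝ, E) ∞ M] [IsManifold 𝓘(ℝ, E') ∞ S]

namespace IsAdapted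

variable {i : S → M} {φ : OpenPartialHomeomorph S E'} {ψ : OpenPartialHomeomorph M E}
  {ι : E' →L[ℝ] E} {ρ : E →L[ℝ] E'} (h : IsAdapted i φ ψ ι ρ)
  (F : Metric E M) (hi : Manifold.IsImmersion 𝓘(ℝ, E') 𝓘(ℝ, E) ∞ i)
  (hnd : F.IsNondegenerateAlong (E' := E') i)
include h

theorem map_mem_coordA {z : E' × E'} (hz : z ∈ (F.restrict hi hnd).coordA φ) :
    ι.prodMap ι z ∈ F.coordA ψ := by
  have hs : (tangentCoordSymm φ z).proj ∈ φ.source := φ.map_target hz.1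
  have hA : push E i (tangentCoordSymm φ z) ∈ F.A := hz.2
  have := tangentCoord_mem_coordA F h.cod_mem hA (h.mapsTo _ hs)
  rwa [h.tangentCoord_push hs, tangentCoord_tangentCoordSymm h.dom_mem hz.1] at this

theorem coordL_restrict {z : E' × E'} (hz : z ∈ (F.restrict hi hnd).coordA φ) :
    (F.restrict hi hnd).coordL φ z = F.coordL ψ (ι.prodMap ι z) :=
  congrArg F.L (h.push_tangentCoordSymm hz.1)

variable [FiniteDimensional ℝ E] [FiniteDimensional ℝ E']

/-- The tangential part of the ambient acceleration, if there is no normal part. -/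
theorem christoffel_radial_eq {z : E' × E'} (hz : z ∈ (F.restrict hi hnd).coordA φ) {n : E'}
    (hn : christoffel (F.coordL ψ) (ι.prodMap ι z) (ι z.2) (ι z.2) = ι n) :
    n = christoffel ((F.restrict hi hnd).coordL φ) z z.2 z.2 :=
  (isLocalMetric_coord F h.cod_mem).christoffel_radial_restrict
    (isLocalMetric_coord (F.restrict hi hnd) h.dom_mem)
    (fun _ hy => h.map_mem_coordA F hi hnd hy) (fun _ hy => h.coordL_restrict F hi hnd hy) hz hn

/-- The differentiation terms of the two connections cancel. The rest, Γ(ιu,ιw) - ιΓ'(u,w), is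
g_v-orthogonal to S, so the intrinsic derivative is the tangential projection of the ambient one. -/
theorem differenceTensor_eq_zero {v : TangentBundle 𝓘(ℝ, E') S} (hv : v.proj ∈ φ.source)
    (hA : push E i v ∈ F.A) (hII : ∀ u, F.secondForm i v v.2 u = 0)
    (u w : TangentSpace 𝓘(ℝ, E') v.proj) : F.differenceTensor hi hnd v u w = 0 := by
  have hz := tangentCoord_mem_coordA (F.restrict hi hnd) h.dom_mem (v := v) hA hv
  have hr (a : E') : ∃ n, christoffel (F.coordL ψ) (ι.prodMap ι (tangentCoord φ v))
      (ι (tangentCoord φ v).2) (ι a) = ι n := by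
    have := (h.secondForm_eq_zero_iff F hnd hv hA _ _).1 (hII ((dcoord φ v.proj).inverse a))
    rwa [dcoord_inverse h.dom_mem hv] at this
  rw [Metric.differenceTensor, sub_eq_zero, Metric.induced]
  refine h.tangentPart_eq F hnd hv hA fun a => ?_
  rw [h.dcoord_ambient F hv hA (smoothNear_extend u) (smoothNear_extend w),
    dcoord_chern (F.restrict hi hnd) h.dom_mem hA hv (smoothNear_extend u) (smoothNear_extend w),
    Metric.covCoord, map_add]
  have h1 : (tangentCoord φ v).1 = φ v.proj := rfl
  rw [h1, fieldCoord_apply hv, fieldCoord_apply hv, FiberBundle.extend_apply_self,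
    FiberBundle.extend_apply_self, add_sub_add_left_eq_sub]
  exact (isLocalMetric_coord F h.cod_mem).fiberHessian_christoffel_sub_eq_zero
    (isLocalMetric_coord (F.restrict hi hnd) h.dom_mem)
    (fun _ hy => h.map_mem_coordA F hi hnd hy) (fun _ hy => h.coordL_restrict F hi hnd hy)
    hz hr _ _ _

include hi hnd in
theorem secondForm_eq_zero_of_radial
    (hII : ∀ v : TangentBundle 𝓘(ℝ, E') S, push E i v ∈ F.A → F.secondForm i v v.2 v.2 = 0)
    {v : TangentBundle 𝓘(ℝ, E') S} (hv : v.proj ∈ φ.source)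
    (hA : push E i v ∈ F.A) (u : TangentSpace 𝓘(ℝ, E') v.proj) :
    F.secondForm i v v.2 u = 0 := by
  have hz := tangentCoord_mem_coordA (F.restrict hi hnd) h.dom_mem (v := v) hA hv
  rw [h.secondForm_eq_zero_iff F hnd hv hA]
  refine (isLocalMetric_coord F h.cod_mem).christoffel_mem_range
    (isLocalMetric_coord (F.restrict hi hnd) h.dom_mem)
    (fun _ hy => h.map_mem_coordA F hi hnd hy) (fun z hz => ?_) hz _
  have hs : (tangentCoordSymm φ z).proj ∈ φ.source := φ.map_target hz.1
  have h1 := (h.secondForm_eq_zero_iff F hnd hs hz.2 _ _).1 (hII (tangentCoordSymm φ z) hz.2)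
  have h2 : dcoord φ (tangentCoordSymm φ z).proj (tangentCoordSymm φ z).2 = z.2 :=
    dcoord_dcoordSymm h.dom_mem hz.1 z.2
  rwa [tangentCoord_tangentCoordSymm h.dom_mem hz.1, h2] at h1

end IsAdapted

variable [FiniteDimensional ℝ E] [FiniteDimensional ℝ E']

omit [IsManifold 𝓘(ℝ, E') ∞ S] [IsManifold 𝓘(ℝ, E) ∞ M] [FiniteDimensional ℝ E]
  [FiniteDimensional ℝ E'] in
theorem velocity_comp {i : S → M} {γ : ℝ → S} {t : ℝ}
    (hi : MDifferentiableAt 𝓘(ℝ, E') 𝓘(ℝ, E) i (γ t))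
    (hγ : MDifferentiableAt 𝓘(ℝ, ℝ) 𝓘(ℝ, E') γ t) :
    velocity (i ∘ γ) t = push E i (velocity (E := E') γ t) := by
  refine tangentBundle_mk_eq rfl ?_
  rw [mfderiv_comp (I' := 𝓘(ℝ, E')) t hi hγ]
  rfl

/-- Without normal part, the ambient acceleration of a geodesic of S is the image under ι of its
acceleration in S, which is zero. An extension to M of the field that witnesses the geodesic
equation in S serves as witness in M. -/
theorem isTotallyGeodesic_of_secondForm {F : Metric E M} {i : S → M}
    (hi : Manifold.IsImmersion 𝓘(ℝ, E') 𝓘(ℝ, E) ∞ i) (hnd : F.IsNondegenerateAlong (E' := E') i)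
    (hII : ∀ v : TangentBundle 𝓘(ℝ, E') S, push E i v ∈ F.A → F.secondForm i v v.2 v.2 = 0) :
    F.IsTotallyGeodesic hi hnd := by
  rintro γ J ⟨hJ, hJc, hγ, hgeo⟩
  refine ⟨hJ, hJc, hi.contMDiff.comp_contMDiffOn hγ, fun t ht => ?_⟩
  have hγd (s : ℝ) (hs : s ∈ J) : MDifferentiableAt 𝓘(ℝ, ℝ) 𝓘(ℝ, E') γ s :=
    (hγ.contMDiffAt (hJ.mem_nhds hs)).mdifferentiableAt (by simp)
  have hid (q : S) : MDifferentiableAt 𝓘(ℝ, E') 𝓘(ℝ, E) i q :=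
    hi.contMDiff.mdifferentiableAt (by simp)
  obtain ⟨hA, X, hX, hXγ, hXX⟩ := hgeo t ht
  have hA' : push E i (velocity (E := E') γ t) ∈ F.A := hA
  obtain ⟨φ, ψ, ι, ρ, h, hs⟩ := exists_isAdapted hi (γ t)
  have hX' := h.isExtension_someExtension hs hX
  set X' := someExtension (E := E) i (γ t) X
  have hv : velocity (E := E) (i ∘ γ) t = push E i (velocity (E := E') γ t) :=
    velocity_comp (hid _) (hγd t ht)
  rw [hv]
  refine ⟨hA', X', hX'.1, ?_, ?_⟩
  · filter_upwards [(hγd t ht).continuousAt.eventually hX'.2, hXγ, hJ.mem_nhds ht] with s h1 h2 h3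
    have h4 : velocity (E := E) (i ∘ γ) s = push E i (velocity (E := E') γ s) :=
      velocity_comp (hid _) (hγd s h3)
    rw [Function.comp_apply, h1, h2, h4]
    rfl
  · have hs' : (velocity (E := E') γ t).proj ∈ φ.source := hs
    have hXt : X (γ t) = (velocity (E := E') γ t).2 := hXγ.self_of_nhds
    have hz := tangentCoord_mem_coordA (F.restrict hi hnd) h.dom_mem hA hs
    obtain ⟨n, hn⟩ := (h.secondForm_eq_zero_iff F hnd hs' hA' _ _).1 (hII _ hA')
    have hn' := h.christoffel_radial_eq F hi hnd hz hn
    have h1 := dcoord_chern (F.restrict hi hnd) h.dom_mem hA hs hX hX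
    have h2 := dcoord_chern F h.cod_mem hA' (h.mapsTo _ hs) hX'.1 hX'.1
    rw [h.covCoord_extension F hs' hX hX' hX'] at h2
    rw [hXX, map_zero, Metric.covCoord] at h1
    refine dcoord_injective h.cod_mem (h.mapsTo _ hs) (h2.trans ?_)
    have h3 : X (velocity (E := E') γ t).proj = (velocity (E := E') γ t).2 := hXt
    have h4 : fieldCoord φ X (tangentCoord φ (velocity (E := E') γ t)).1
        = (tangentCoord φ (velocity (E := E') γ t)).2 :=
      (fieldCoord_apply hs X).trans (congrArg _ hXt)
    rw [h4, ← hn'] at h1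
    rw [h3, hn, ← map_add]
    refine Eq.trans (congrArg ι h1.symm) ?_
    exact (map_zero ι).trans (map_zero (dcoord ψ (i (γ t)))).symm

end Submanifold

/-! ### Smooth integral curves and fields extending a velocity -/

section Curves

variable {V : Type*} [NormedAddCommGroup V] [NormedSpace ℝ V]

/-- The velocity of a regular curve extends locally to a smooth vector field. -/
theorem exists_field_extending_velocity {c w : ℝ → V} {J : Set ℝ} (hJ : IsOpen J)
    (hw : ContDiffOn ℝ ∞ w J) (hcw : ∀ s ∈ J, HasDerivAt c (w s) s)
    (hc : ContDiffOn ℝ ∞ c J) {t : ℝ} (ht : t ∈ J) (h0 : w t ≠ 0) :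
    ∃ X : V → V, (∀ᶠ x in 𝓝 (c t), ContDiffAt ℝ ∞ X x) ∧ ∀ᶠ s in 𝓝 t, X (c s) = w s := by
  -- A functional l with l(w t) ≠ 0 makes l ∘ c a local diffeomorphism at t, so time can be read off
  -- from position: X = w ∘ (l ∘ c)⁻¹ ∘ l.
  obtain ⟨l, hl⟩ := SeparatingDual.exists_ne_zero (R := ℝ) h0
  have hf (s : ℝ) (hs : s ∈ J) : ContDiffAt ℝ ∞ (l ∘ c) s :=
    l.contDiff.contDiffAt.comp s (hc.contDiffAt (hJ.mem_nhds hs))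
  have hf' (s : ℝ) (hs : s ∈ J) : HasDerivAt (l ∘ c) (l (w s)) s :=
    l.hasFDerivAt.comp_hasDerivAt s (hcw s hs)
  have hu := (hf' t ht).hasFDerivAt_equiv hl
  set f := (hf t ht).toOpenPartialHomeomorph (l ∘ c) hu (by simp)
  have hfc (s : ℝ) : f s = l (c s) := rfl
  have hts : t ∈ f.source := (hf t ht).mem_toOpenPartialHomeomorph_source hu (by simp)
  refine ⟨w ∘ f.symm ∘ l, ?_, ?_⟩
  · have h1 : ∀ᶠ s in 𝓝 t, s ∈ J ∧ l (w s) ≠ 0 :=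
      (hJ.eventually_mem ht).and ((l.continuous.continuousAt.comp
        (hw.continuousOn.continuousAt (hJ.mem_nhds ht))).eventually_ne hl)
    have h2 : ∀ᶠ y in 𝓝 (f t), y ∈ f.target ∧ f.symm y ∈ J ∧ l (w (f.symm y)) ≠ 0 :=
      (f.open_target.eventually_mem (f.map_source hts)).and ((f.tendsto_symm hts).eventually h1)
    filter_upwards [l.continuous.continuousAt.eventually h2] with x ⟨hx, hxJ, hx0⟩
    have h3 := f.contDiffAt_symm_deriv hx0 hx (hf' _ hxJ) (hf _ hxJ)
    have h4 : ContDiffAt ℝ ∞ (w ∘ f.symm) (l x) := (hw.contDiffAt (hJ.mem_nhds hxJ)).comp _ h3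
    exact ContDiffAt.comp (g := w ∘ f.symm) x h4 l.contDiff.contDiffAt
  · filter_upwards [f.open_source.mem_nhds hts] with s hs
    rw [Function.comp_apply, Function.comp_apply, ← hfc, f.left_inv hs]

/-- Bootstrapping: if α is Cⁿ, then so is its derivative f ∘ α, and α is Cⁿ⁺¹. -/
theorem contDiffOn_of_hasDerivAt {f : V → V} {U : Set V} (hf : ContDiffOn ℝ ∞ f U) {α : ℝ → V}
    {J : Set ℝ} (hJ : IsOpen J) (hα : ∀ t ∈ J, α t ∈ U ∧ HasDerivAt α (f (α t)) t) :
    ContDiffOn ℝ ∞ α J := by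
  rw [contDiffOn_infty]
  intro n
  have hd : DifferentiableOn ℝ α J := fun t ht =>
    (hα t ht).2.differentiableAt.differentiableWithinAt
  induction n with
  | zero => exact contDiffOn_zero.2 hd.continuousOn
  | succ n ih =>
    rw [Nat.cast_succ, contDiffOn_succ_iff_deriv_of_isOpen hJ]
    refine ⟨hd, by simp, ?_⟩
    exact ((hf.of_le (by exact_mod_cast le_top)).comp ih fun t ht => (hα t ht).1).congr
      fun t ht => (hα t ht).2.deriv

/-- Short-time existence of smooth integral curves. -/
theorem exists_integral_curve [CompleteSpace V] {f : V → V} {U : Set V} (hU : IsOpen U)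
    (hf : ContDiffOn ℝ ∞ f U) {x : V} (hx : x ∈ U) :
    ∃ α : ℝ → V, ∃ ε > 0, α 0 = x ∧
      (∀ t ∈ Set.Ioo (-ε) ε, α t ∈ U ∧ HasDerivAt α (f (α t)) t) ∧
      ContDiffOn ℝ ∞ α (Set.Ioo (-ε) ε) := by
  obtain ⟨α, h0, ε, hε, hα⟩ :=
    ContDiffAt.exists_forall_mem_closedBall_exists_eq_forall_mem_Ioo_hasDerivAt₀
    ((hf.contDiffAt (hU.mem_nhds hx)).of_le (by exact_mod_cast le_top)) 0
  rw [zero_sub, zero_add] at hα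
  have hc : ContinuousAt α 0 := (hα 0 ⟨by linarith, hε⟩).continuousAt
  have hm : ∀ᶠ t in 𝓝 (0 : ℝ), α t ∈ U := hc.eventually (hU.mem_nhds (by rwa [h0]))
  -- Picard-Lindelöf does not keep the solution inside U; continuity at 0 does, on a shorter
  -- interval.
  obtain ⟨δ, hδ, hδU⟩ := Metric.eventually_nhds_iff.1 hm
  have key : ∀ t ∈ Set.Ioo (-min ε δ) (min ε δ), α t ∈ U ∧ HasDerivAt α (f (α t)) t := by
    intro t ht
    have h1 := min_le_left ε δ
    have h2 := min_le_right ε δ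
    refine ⟨hδU ?_, hα t ⟨by linarith [ht.1], by linarith [ht.2]⟩⟩
    rw [Real.dist_eq, sub_zero, abs_lt]
    exact ⟨by linarith [ht.1], by linarith [ht.2]⟩
  exact ⟨α, min ε δ, lt_min hε hδ, h0, key, contDiffOn_of_hasDerivAt hf isOpen_Ioo key⟩

end Curves

/-! ### Geodesics in a chart and their short-time existence -/

section Geodesic

variable {E : Type*} [NormedAddCommGroup E] [NormedSpace ℝ E]
  {M : Type*} [TopologicalSpace M] [ChartedSpace E M]

theorem velocity_comp_symm {e : OpenPartialHomeomorph M E}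
    (he : e ∈ IsManifold.maximalAtlas 𝓘(ℝ, E) ∞ M) {c : ℝ → E} {t : ℝ} {a : E}
    (ht : c t ∈ e.target) (hc : HasDerivAt c a t) :
    velocity (e.symm ∘ c) t = tangentCoordSymm e (c t, a) := by
  refine tangentBundle_mk_eq rfl ?_
  rw [mfderiv_comp (I' := 𝓘(ℝ, E)) t
    ((mdifferentiable_of_mem_maximalAtlas he).mdifferentiableAt_symm ht)
    hc.differentiableAt.mdifferentiableAt, mfderiv_eq_fderiv, hc.hasFDerivAt.fderiv]
  change dcoordSymm e (c t) ((1 : ℝ) • a) = _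
  rw [one_smul]

variable [IsManifold 𝓘(ℝ, E) ∞ M] [FiniteDimensional ℝ E]

/-- The covariant acceleration of a curve in a chart. -/
theorem dcoord_chern_velocity (F : Metric E M) {e : OpenPartialHomeomorph M E}
    (he : e ∈ IsManifold.maximalAtlas 𝓘(ℝ, E) ∞ M) {v : TangentBundle 𝓘(ℝ, E) M} (hv : v ∈ F.A)
    (hp : v.proj ∈ e.source) {c w : ℝ → E} {t : ℝ} {a : E} (hz : tangentCoord e v = (c t, w t))
    (hc : HasDerivAt c (w t) t) (hw : HasDerivAt w a t) {X : VField E M}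
    (hX : SmoothNear X v.proj) (hXc : ∀ᶠ s in 𝓝 t, fieldCoord e X (c s) = w s) :
    dcoord e v.proj (F.chern v X X) = a + christoffel (F.coordL e) (c t, w t) (w t) (w t) := by
  have h1 : e v.proj = c t := congrArg Prod.fst hz
  have hd := (hX.contDiffAt_fieldCoord he hp).differentiableAt (by simp)
  rw [h1] at hd
  have h2 : HasDerivAt (fieldCoord e X ∘ c) (fderiv ℝ (fieldCoord e X) (c t) (w t)) t :=
    hd.hasFDerivAt.comp_hasDerivAt t hc
  rw [dcoord_chern F he hv hp hX hX, Metric.covCoord, hz, hXc.self_of_nhds,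
    (h2.congr_of_eventuallyEq (hXc.mono fun s hs => hs.symm)).unique hw]

/-- Solutions of the geodesic equation in a chart exist. -/
theorem exists_isGeodesic (F : Metric E M) {e : OpenPartialHomeomorph M E}
    (he : e ∈ IsManifold.maximalAtlas 𝓘(ℝ, E) ∞ M) {z : E × E} (hz : z ∈ F.coordA e) :
    ∃ (c w : ℝ → E) (J : Set ℝ), F.IsGeodesic (e.symm ∘ c) J ∧ 0 ∈ J ∧ c 0 = z.1 ∧ w 0 = z.2 ∧
      ∀ t ∈ J, c t ∈ e.target ∧ HasDerivAt c (w t) t ∧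
        HasDerivAt w (-christoffel (F.coordL e) (c t, w t) (w t) (w t)) t := by
  have : CompleteSpace E := FiniteDimensional.complete ℝ E
  have hm := isLocalMetric_coord F he
  -- The geodesic equation as a first-order system: c' = w, w' = -Γ(w,w).
  have hf : ContDiffOn ℝ ∞
      (fun y : E × E => (y.2, -christoffel (F.coordL e) y y.2 y.2)) (F.coordA e) :=
    contDiffOn_snd.prodMk
      ((hm.contDiffOn_christoffel.clm_apply contDiffOn_snd).clm_apply contDiffOn_snd).neg
  obtain ⟨α, ε, hε, h0, hα, hαs⟩ := exists_integral_curve hm.isOpen hf hz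
  set J := Set.Ioo (-ε) ε
  have hc (t : ℝ) (ht : t ∈ J) : HasDerivAt (fun s => (α s).1) (α t).2 t :=
    (hasFDerivAt_fst (𝕜 := ℝ) (p := α t)).comp_hasDerivAt t (hα t ht).2
  have hw (t : ℝ) (ht : t ∈ J) : HasDerivAt (fun s => (α s).2)
      (-christoffel (F.coordL e) (α t) (α t).2 (α t).2) t :=
    (hasFDerivAt_snd (𝕜 := ℝ) (p := α t)).comp_hasDerivAt t (hα t ht).2
  have hvel (t : ℝ) (ht : t ∈ J) :
      velocity (e.symm ∘ fun s => (α s).1) t = tangentCoordSymm e (α t) :=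
    velocity_comp_symm he (hα t ht).1.1 (hc t ht)
  have hJ : IsOpen J := isOpen_Ioo
  refine ⟨fun s => (α s).1, fun s => (α s).2, J, ⟨hJ, Set.ordConnected_Ioo, ?_, ?_⟩,
    ⟨by linarith, hε⟩, congrArg Prod.fst h0, congrArg Prod.snd h0,
    fun t ht => ⟨(hα t ht).1.1, hc t ht, hw t ht⟩⟩
  · exact (contMDiffOn_symm_of_mem_maximalAtlas he).comp hαs.fst.contMDiffOn
      fun t ht => (hα t ht).1.1
  · intro t ht
    have hA := (hα t ht).1.2
    -- A contains no zero vectors, so the curve is regular and its velocity extends to a field, as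
    -- `Metric.IsGeodesic` demands.
    have h2 : (α t).2 ≠ 0 := by
      intro h
      refine F.ne_zero _ hA ?_
      change dcoordSymm e (α t).1 (α t).2 = 0
      rw [h, map_zero]
    obtain ⟨X, hX, hXc⟩ := exists_field_extending_velocity hJ hαs.snd hc hαs.fst ht h2
    have hs : (tangentCoordSymm e (α t)).proj ∈ e.source := e.map_target (hα t ht).1.1
    have hXs : SmoothNear (ofFieldCoord e X) (tangentCoordSymm e (α t)).proj := by
      refine smoothNear_ofFieldCoord he hs ?_
      have : e (tangentCoordSymm e (α t)).proj = (α t).1 := e.right_inv (hα t ht).1.1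
      rwa [this]
    have hXe : ∀ᶠ s in 𝓝 t, fieldCoord e (ofFieldCoord e X) (α s).1 = (α s).2 := by
      filter_upwards [hXc, hJ.mem_nhds ht] with s h1 h3
      rw [fieldCoord_ofFieldCoord he (hα s h3).1.1, h1]
    rw [hvel t ht]
    refine ⟨hA, ofFieldCoord e X, hXs, ?_, ?_⟩
    · filter_upwards [hXe, hJ.mem_nhds ht] with s h1 h3
      have ht' := (hα s h3).1.1
      rw [hvel s h3]
      refine dcoord_injective he (e.map_target ht') (Eq.trans ?_
        (dcoord_dcoordSymm he ht' (α s).2).symm)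
      exact h1
    · refine dcoord_injective he hs ?_
      rw [map_zero, dcoord_chern_velocity F he hA hs
        (tangentCoord_tangentCoordSymm he (hα t ht).1.1) (hc t ht) (hw t ht) hXs hXe]
      exact neg_add_cancel _

end Geodesic

/-! ### Totally geodesic submanifolds have II_v(v,v) = 0 -/

section Submanifold

variable {E : Type*} [NormedAddCommGroup E] [NormedSpace ℝ E]
  {M : Type*} [TopologicalSpace M] [ChartedSpace E M]
  {E' : Type*} [NormedAddCommGroup E'] [NormedSpace ℝ E']
  {S : Type*} [TopologicalSpace S] [ChartedSpace E' S]
  [IsManifold 𝓘(ℝ, E) ∞ M] [IsManifold 𝓘(ℝ, E') ∞ S]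
  [FiniteDimensional ℝ E] [FiniteDimensional ℝ E']

/-- The geodesic of S with initial velocity v solves both geodesic equations. Its coordinate
acceleration in M is the image under ι of that in S, so at time 0 the ambient spray equals the image
of the spray of S and is tangent to S. -/
theorem secondForm_eq_zero_of_isTotallyGeodesic {F : Metric E M} {i : S → M}
    {hi : Manifold.IsImmersion 𝓘(ℝ, E') 𝓘(ℝ, E) ∞ i} {hnd : F.IsNondegenerateAlong (E' := E') i}
    (hT : F.IsTotallyGeodesic hi hnd) {v : TangentBundle 𝓘(ℝ, E') S} (hA : push E i v ∈ F.A) :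
    F.secondForm i v v.2 v.2 = 0 := by
  obtain ⟨φ, ψ, ι, ρ, h, hs⟩ := exists_isAdapted hi v.proj
  obtain ⟨c, w, J, hγ, h0, hc0, hw0, hJ⟩ := exists_isGeodesic (F.restrict hi hnd) h.dom_mem
    (tangentCoord_mem_coordA (F.restrict hi hnd) h.dom_mem (v := v) hA hs)
  have hJo : IsOpen J := hγ.1
  have hvel (t : ℝ) (ht : t ∈ J) : velocity (E := E) (i ∘ φ.symm ∘ c) t
      = push E i (tangentCoordSymm φ (c t, w t)) := by
    have h1 := velocity_comp_symm h.dom_mem (hJ t ht).1 (hJ t ht).2.1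
    rw [← h1]
    exact velocity_comp (hi.contMDiff.mdifferentiableAt (by simp))
      ((hγ.2.2.1.contMDiffAt (hJo.mem_nhds ht)).mdifferentiableAt (by simp))
  obtain ⟨-, -, -, hF⟩ := hT _ J hγ
  obtain ⟨hA0, X, hX, hXγ, hXX⟩ := hF 0 h0
  have hp0 : (velocity (E := E) (i ∘ φ.symm ∘ c) 0).proj ∈ ψ.source :=
    h.mapsTo _ (φ.map_target (hJ 0 h0).1)
  have hcoord (t : ℝ) (ht : t ∈ J) :
      tangentCoord ψ (velocity (E := E) (i ∘ φ.symm ∘ c) t) = (ι (c t), ι (w t)) := by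
    rw [hvel t ht, h.tangentCoord_push (φ.map_target (hJ t ht).1),
      tangentCoord_tangentCoordSymm h.dom_mem (hJ t ht).1]
    rfl
  have hXc : ∀ᶠ s in 𝓝 0, fieldCoord ψ X (ι (c s)) = ι (w s) := by
    filter_upwards [hXγ, hJo.mem_nhds h0] with s h1 h2
    have h3 := hcoord s h2
    have h4 : ψ (i (φ.symm (c s))) = ι (c s) := congrArg Prod.fst h3
    rw [← h4, fieldCoord_apply (h.mapsTo _ (φ.map_target (hJ s h2).1))]
    exact (congrArg _ h1).trans (congrArg Prod.snd h3)
  -- As ι is linear, the curve in M has coordinates ι ∘ c, velocity ι ∘ w and acceleration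
  -- -ι(Γ'(w,w)).
  have key := dcoord_chern_velocity F h.cod_mem hA0 hp0 (hcoord 0 h0)
    (ι.hasFDerivAt.comp_hasDerivAt 0 (hJ 0 h0).2.1)
    (ι.hasFDerivAt.comp_hasDerivAt 0 (hJ 0 h0).2.2) hX hXc
  rw [hXX, map_zero] at key
  rw [h.secondForm_eq_zero_iff F hnd hs hA]
  refine ⟨christoffel ((F.restrict hi hnd).coordL φ) (c 0, w 0) (w 0) (w 0), ?_⟩
  rw [map_neg] at key
  have hz : ι.prodMap ι (tangentCoord φ v) = (ι (c 0), ι (w 0)) := by rw [hc0, hw0]; rfl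
  have hz2 : dcoord φ v.proj v.2 = w 0 := hw0.symm
  rw [hz, hz2]
  exact (neg_add_eq_zero.1 key.symm).symm

end Submanifold

end PseudoFinsler

end

theorem proposition3
    {E : Type*} [NormedAddCommGroup E] [NormedSpace ℝ E] [FiniteDimensional ℝ E]
    {M : Type*} [TopologicalSpace M] [T2Space M] [ChartedSpace E M] [IsManifold 𝓘(ℝ, E) ∞ M]
    {E' : Type*} [NormedAddCommGroup E'] [NormedSpace ℝ E'] [FiniteDimensional ℝ E']
    {S : Type*} [TopologicalSpace S] [T2Space S] [ChartedSpace E' S] [IsManifold 𝓘(ℝ, E') ∞ S]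
    (F : PseudoFinsler.Metric E M) (i : S → M)
    (hi : Manifold.IsImmersion 𝓘(ℝ, E') 𝓘(ℝ, E) ∞ i)
    (hnd : F.IsNondegenerateAlong (E' := E') i) :
    (F.IsTotallyGeodesic hi hnd ↔
      ∀ v : TangentBundle 𝓘(ℝ, E') S, PseudoFinsler.push E i v ∈ F.A →
        F.secondForm i v v.2 v.2 = 0) ∧
    ((∀ v : TangentBundle 𝓘(ℝ, E') S, PseudoFinsler.push E i v ∈ F.A →
        F.secondForm i v v.2 v.2 = 0) ↔
      ∀ v : TangentBundle 𝓘(ℝ, E') S, PseudoFinsler.push E i v ∈ F.A →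
        ∀ u : TangentSpace 𝓘(ℝ, E') v.proj, F.secondForm i v v.2 u = 0) ∧
    (F.IsTotallyGeodesic hi hnd →
      ∀ v : TangentBundle 𝓘(ℝ, E') S, PseudoFinsler.push E i v ∈ F.A →
        ∀ u w : TangentSpace 𝓘(ℝ, E') v.proj, F.differenceTensor hi hnd v u w = 0) := by
  have hII : F.IsTotallyGeodesic hi hnd ↔ ∀ v : TangentBundle 𝓘(ℝ, E') S,
      PseudoFinsler.push E i v ∈ F.A → F.secondForm i v v.2 v.2 = 0 :=
    ⟨fun hT _ hv => PseudoFinsler.secondForm_eq_zero_of_isTotallyGeodesic hT hv,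
      fun h => PseudoFinsler.isTotallyGeodesic_of_secondForm hi hnd h⟩
  have hrad (h : ∀ v : TangentBundle 𝓘(ℝ, E') S, PseudoFinsler.push E i v ∈ F.A →
      F.secondForm i v v.2 v.2 = 0) (v : TangentBundle 𝓘(ℝ, E') S)
      (hv : PseudoFinsler.push E i v ∈ F.A) (u : TangentSpace 𝓘(ℝ, E') v.proj) :
      F.secondForm i v v.2 u = 0 := by
    obtain ⟨φ, ψ, ι, ρ, ha, hs⟩ := PseudoFinsler.exists_isAdapted hi v.proj
    exact ha.secondForm_eq_zero_of_radial F hi hnd h hs hv u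
  refine ⟨hII, ⟨hrad, fun h v hv => h v hv v.2⟩, fun hT v hv u w => ?_⟩
  obtain ⟨φ, ψ, ι, ρ, ha, hs⟩ := PseudoFinsler.exists_isAdapted hi v.proj
  exact ha.differenceTensor_eq_zero F hi hnd hs hv (hrad (hII.1 hT) v hv) u w
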